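/- **Theorem 1.2.** Let $X, X_1, X_2, \dots$ be i.i.d. real random variables with $\mathbb E X = 0$, $\operatorname{Var}(X) = 1$ and $\mathbb E\, e^{b|X|} < \infty$ for some $b>0$. Put $Z_n = (X_1+\dots+X_n)/\sqrt n$ and assume that $Z_{n_0}$ has a bounded density for some $n_0 \ge 1$. Let $\varphi(x) = \frac1{\sqrt{2\pi}} e^{-x^2/2}$, let $K(z) = \log \mathbb E\, e^{zX}$ (principal branch, for complex $z$ near $0$), and let $\gamma_k = K^{(k)}(0)$ be the cumulants of $X$. Then there are constants $\tau_0 > 0$ and $C$, depending only on the distribution of $X$ and on $n_0$, such that the following holds. (a) There is an analytic function $z_0$ on the disc $|\tau|\le\tau_0$ of the complex plane with $z_0(0)=0$ and $K'(z_0(\tau)) = \tau$ (the saddle point), and the functions $$\lambda(\tau) = \tau^{-3}\Big(K(z_0(\tau)) - \tau z_0(\tau) + \tfrac12 \tau^2\Big) \ \text{ (Cramér's series)}, \qquad \mu(\tau) = \tfrac12 \log K''(z_0(\tau))$$ are analytic in $|\tau|\le\tau_0$ ($\lambda$ after removing the singularity at $0$) and real for real $\tau$, with $\mu(0)=0$.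 (b) For every $n \ge 2n_0$, $Z_n$ has a continuous bounded density $p_n$, and for all real $x$ such that $\tau = x/\sqrt n$ satisfies $|\tau|\le\tau_0$, $$\frac{p_n(x)}{\varphi(x)} = e^{n\tau^3\lambda(\tau)-\mu(\tau)}\Big(1 + B\,\frac{(\log n)^3}{n}\Big), \qquad |B| = |B(n,x)| \le C.$$ (c) If $X$ is not normal, then $X$ has a non-zero cumulant of order at least $3$, and if $\gamma_m$ ($m\ge3$) is the first such cumulant, then, as $\tau\to0$, $$\lambda(\tau) = \frac{\gamma_m}{m!}\,\tau^{m-3} + O(|\tau|^{m-2}), \qquad \mu(\tau) = \frac{\gamma_m}{2(m-2)!}\,\tau^{m-2} + O(|\tau|^{m-1}).$$ -/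

import Mathlib

open MeasureTheory ProbabilityTheory Topology

/-- `q` is a version of the Lebesgue density of the measure `ν` on the real line. -/
structure IsDensity (ν : Measure ℝ) (q : ℝ → ℝ) : Prop where
  measurable : Measurable q
  nonneg : ∀ x, 0 ≤ q x
  eq_withDensity : ν = volume.withDensity (fun x => ENNReal.ofReal (q x))

/-- The normalized sum `Z_n = (X_1 + ⋯ + X_n) / √n`; the sequence is indexed from `0`. -/
noncomputable def normalizedSum {Ω : Type*} (X : ℕ → Ω → ℝ) (n : ℕ) (ω : Ω) : ℝ :=
  (∑ i ∈ Finset.range n, X i ω) / √(n : ℝ)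

/-- The log-Laplace transform `K(z) = log E e^{zX}` of a complex variable, with the principal
branch of the logarithm; it is only used near `z = 0`, where `E e^{zX}` is close to `1`. -/
noncomputable def logLaplace {Ω : Type*} [MeasurableSpace Ω] (X : Ω → ℝ) (P : Measure Ω)
    (z : ℂ) : ℂ :=
  Complex.log (complexMGF X P z)

/-- The `k`-th cumulant of `X`: the `k`-th derivative at `0` of `t ↦ log E e^{tX}`. -/
noncomputable def cumulant {Ω : Type*} [MeasurableSpace Ω] (X : Ω → ℝ) (P : Measure Ω)
    (k : ℕ) : ℝ :=
  iteratedDeriv k (cgf X P) 0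

/-- `m` is the order of the first non-zero cumulant of order at least `3`. -/
structure IsFirstCumulantOrder {Ω : Type*} [MeasurableSpace Ω] (X : Ω → ℝ) (P : Measure Ω)
    (m : ℕ) : Prop where
  three_le : 3 ≤ m
  ne_zero : cumulant X P m ≠ 0
  eq_zero : ∀ k, 3 ≤ k → k < m → cumulant X P k = 0

/-- `z₀` is the analytic branch, on the disc `|τ| ≤ r`, of the saddle point: the solution of
`K'(z₀(τ)) = τ` with `z₀(0) = 0`. -/
structure IsSaddlePoint {Ω : Type*} [MeasurableSpace Ω] (X : Ω → ℝ) (P : Measure Ω)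
    (r : ℝ) (z₀ : ℂ → ℂ) : Prop where
  analytic : AnalyticOnNhd ℂ z₀ (Metric.closedBall 0 r)
  zero : z₀ 0 = 0
  deriv_eq : ∀ τ ∈ Metric.closedBall (0 : ℂ) r, deriv (logLaplace X P) (z₀ τ) = τ

/-!
# Large deviations of densities: Cramér's series with relative error `O((log n)³ / n)`

Write `L(z) = E e^{zX}` and `K = log L`. The density `p` of `S_n = X_1 + ⋯ + X_n` is recovered by
Fourier inversion on the vertical line through a real point `h`,
`p(s) e^{hs} = (2π)⁻¹ ∫ L(h + it)ⁿ e^{-its} dt`.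
At `s = nτ` the line through the saddle point `h = z₀(τ)`, where `K'(h) = τ`, makes the linear term
of `K(h + it) - K(h) - itτ` vanish, and Laplace's method gives
`e^{n (K(h) - τh)} (2π n K''(h))^{-1/2} (1 + O(1/n))`.
Dividing by the normal density turns the first factor into `e^{n τ³ λ(τ)}` and the second one into
`e^{-μ(τ)}`. The relative error is thus even `O(1/n)`, which is stronger than `O((log n)³ / n)`
because `n ≥ 2`, and it is uniform in `τ` and in all `n ≥ 2 n₀`.

Three facts make Laplace's method uniform.

* Close to the real axis, `K(h + it)` agrees with its third-order Taylor polynomial up to `O(t⁴)`,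
  uniformly in small `h` (`norm_sub_taylor_le`). The cubic term is odd, so it does not contribute
  at the order `1/n` (`exists_laplace_bound`).
* Away from it, `|L(h + it)| ≤ ρ L(h)` with `ρ < 1`. For `h = 0` this is the Riemann–Lebesgue
  lemma and strict convexity of the unit disc; for small `h` it follows because `L(h + it) - L(it)`
  is `O(h)` uniformly in `t` (`exists_norm_complexMGF_le_mul`).
* If `f ≤ M` is the density of `S_{n₀}`, then `e^{hx} f(x)` is square integrable, and Plancherel's
  formula bounds `∫ |L(h + it)|^{2 n₀} dt` (`integral_norm_complexMGF_pow_le`). This is the reason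
  for the condition `n ≥ 2 n₀`, which also makes the density of `S_n` a convolution of two bounded
  densities, hence continuous.

The analytic statements come from the inverse function theorem for `K'` and from Taylor expansions
of `K` and `K''` to the order of the first non-zero cumulant `γ_m`:
`K(z₀) - τ z₀ + τ²/2 = (z₀ - τ)²/2 + γ_m z₀^m / m! + O(τ^{m+1})`, where the square is of order
`2m - 2 ≥ m + 1` (`saddlePoint_expansions`). If all cumulants of order at least `3` vanish, then
`L(z) = e^{z²/2}` near `0`, hence on a strip, and `X` is normal.
-/

open MeasureTheory ProbabilityTheory Topology

/-! ### Plancherel's formula and convolutions of densities -/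

/-- On `L¹ ∩ L²` the Fourier integral is square integrable, with the same `L²` norm: it represents
the `L²` Fourier transform, because both define the same tempered distribution. -/
theorem integral_norm_sq_fourier {u : ℝ → ℂ} (hu : Integrable u) (hu2 : MemLp u 2) :
    Integrable (fun ξ => ‖FourierTransform.fourier u ξ‖ ^ 2) ∧
      ∫ ξ, ‖FourierTransform.fourier u ξ‖ ^ 2 = ∫ x, ‖u x‖ ^ 2 := by
  set w : Lp (α := ℝ) ℂ 2 := hu2.toLp u with hw
  have hcont : Continuous (FourierTransform.fourier u) :=
    VectorFourier.fourierIntegral_continuous Real.continuous_fourierChar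
      continuous_inner hu
  have hae : ∀ᵐ ξ, FourierTransform.fourier u ξ = (FourierTransform.fourier w : Lp (α := ℝ) ℂ 2) ξ := by
    apply ae_eq_of_integral_contDiff_smul_eq hcont.locallyIntegrable
      ((Lp.memLp _).locallyIntegrable (by norm_num))
    intro g hg hgs
    have hgC : HasCompactSupport (fun x => (g x : ℂ)) :=
      hgs.comp_left (g := fun y : ℝ => (y : ℂ)) (by simp)
    have hgD : ContDiff ℝ (⊤ : ℕ∞) (fun x => (g x : ℂ)) :=
      Complex.ofRealCLM.contDiff.comp hg
    set φ : SchwartzMap ℝ ℂ := hgC.toSchwartzMap hgD with hφ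
    have h1 := Lp.fourier_toTemperedDistribution_eq w
    have h2 := congrArg (fun T => T φ) h1
    simp only [TemperedDistribution.fourier_apply, Lp.toTemperedDistribution_apply] at h2
    have h3 : ∫ x, (FourierTransform.fourier φ : SchwartzMap ℝ ℂ) x • w x =
        ∫ x, (FourierTransform.fourier φ : SchwartzMap ℝ ℂ) x • u x := by
      apply integral_congr_ae
      filter_upwards [hu2.coeFn_toLp] with x hx
      rw [hx]
    have h4 := VectorFourier.integral_fourierIntegral_smul_eq_flip (L := innerₗ ℝ) (μ := volume)
      (ν := volume) (f := φ) (g := u) Real.continuous_fourierChar continuous_inner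
      φ.integrable hu
    simp only [flip_innerₗ] at h4
    rw [h3] at h2
    have h5 : ∀ x, (φ : ℝ → ℂ) x = (g x : ℂ) := fun x => rfl
    simp only [h5] at h2
    calc _ = ∫ x, (φ : ℝ → ℂ) x • FourierTransform.fourier u x := by simp [h5]
      _ = ∫ x, (FourierTransform.fourier φ : SchwartzMap ℝ ℂ) x • u x := by
        rw [SchwartzMap.fourier_coe]; exact h4.symm
      _ = _ := by rw [h2]; simp
  have hm : MemLp (FourierTransform.fourier u) 2 :=
    (Lp.memLp (FourierTransform.fourier w : Lp (α := ℝ) ℂ 2)).ae_eq (by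
      filter_upwards [hae] with x hx using hx.symm)
  refine ⟨hm.integrable_norm_pow (by norm_num), ?_⟩
  have e1 : ∀ v : Lp (α := ℝ) ℂ 2, ‖v‖ ^ 2 = ∫ x, ‖v x‖ ^ 2 := by
    intro v
    have := MeasureTheory.L2.inner_def (𝕜 := ℂ) v v
    rw [inner_self_eq_norm_sq_to_K] at this
    have h2 : ∫ x, inner ℂ (v x) (v x) = ((∫ x, ‖v x‖ ^ 2 : ℝ) : ℂ) := by
      rw [← integral_complex_ofReal]
      congr with x
      rw [inner_self_eq_norm_sq_to_K]; simp
    rw [h2] at this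
    apply Complex.ofReal_injective
    simpa using this
  have e2 := e1 w
  have e3 := e1 (FourierTransform.fourier w : Lp (α := ℝ) ℂ 2)
  rw [Lp.norm_fourier_eq, e2] at e3
  calc _ = ∫ x, ‖(FourierTransform.fourier w : Lp (α := ℝ) ℂ 2) x‖ ^ 2 := by
        apply integral_congr_ae
        filter_upwards [hae] with x hx
        rw [hx]
    _ = ∫ x, ‖w x‖ ^ 2 := e3.symm
    _ = _ := by
        apply integral_congr_ae
        filter_upwards [hu2.coeFn_toLp] with x hx
        rw [hx]

/-- The convolution of an integrable and a bounded function is continuous. -/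
theorem continuous_integral_sub_mul {f g : ℝ → ℝ} (hf : Integrable f) (hg : Measurable g)
    {M : ℝ} (hM : ∀ y, |g y| ≤ M) : Continuous (fun s => ∫ y, f (s - y) * g y) := by
  have hM0 : 0 ≤ M := (abs_nonneg _).trans (hM 0)
  have key : ∀ u : ℝ → ℝ, Integrable u → ∀ s, Integrable (fun y => u (s - y) * g y) := by
    intro u hu s
    exact (hu.comp_sub_left s).mul_bdd hg.aestronglyMeasurable (ae_of_all _ hM)
  -- uniform limits of convolutions with continuous compactly supported functions
  rw [continuous_iff_continuousAt]
  intro s₀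
  apply Metric.continuousAt_iff.2
  intro ε hε
  obtain ⟨u, hus, hu, huc, hui⟩ := hf.exists_hasCompactSupport_integral_sub_le
    (ε := ε / (3 * (M + 1))) (by positivity)
  have hgl : LocallyIntegrable g := by
    apply (locallyIntegrable_const M).mono hg.aestronglyMeasurable
    exact ae_of_all _ fun y => by simpa [abs_of_nonneg hM0] using hM y
  have hc : Continuous (fun s => ∫ y, u (s - y) * g y) := by
    have := hus.continuous_convolution_left (ContinuousLinearMap.mul ℝ ℝ) huc hgl
    convert this using 1
    ext s
    rw [convolution_eq_swap]
    simp
  have hclose : ∀ s, |(∫ y, f (s - y) * g y) - ∫ y, u (s - y) * g y| ≤ ε / 3 := by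
    intro s
    rw [← integral_sub (key f hf s) (key u hui s)]
    calc _ ≤ ∫ y, |f (s - y) * g y - u (s - y) * g y| := abs_integral_le_integral_abs
      _ ≤ ∫ y, ‖f (s - y) - u (s - y)‖ * M := by
        apply integral_mono_of_nonneg (ae_of_all _ fun _ => abs_nonneg _)
        · exact ((hf.sub hui).norm.comp_sub_left s).mul_const M
        · refine ae_of_all _ fun y => ?_
          simp only
          rw [← sub_mul, abs_mul]
          exact mul_le_mul_of_nonneg_left (hM y) (abs_nonneg _)
      _ = (∫ y, ‖f y - u y‖) * M := by
        rw [integral_mul_const, integral_sub_left_eq_self (fun y => ‖f y - u y‖) volume s]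
      _ ≤ ε / (3 * (M + 1)) * M := by gcongr
      _ ≤ ε / 3 := by
        rw [div_mul_eq_mul_div, div_le_div_iff₀ (by positivity) (by positivity)]
        nlinarith
  obtain ⟨δ, hδ, h⟩ := Metric.continuousAt_iff.1 (hc.continuousAt (x := s₀)) (ε / 3) (by positivity)
  refine ⟨δ, hδ, fun {s} hs => ?_⟩
  have h1 := h hs
  have h2 := hclose s
  have h3 := hclose s₀
  rw [Real.dist_eq] at h1 ⊢
  rw [abs_le] at h2 h3
  rw [abs_lt] at h1 ⊢
  constructor <;> linarith

/-! ### Laplace's method with a uniform error -/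

theorem exists_pow_sub_le {ρ : ℝ} (h0 : 0 ≤ ρ) (h1 : ρ < 1) (N : ℕ) :
    ∃ E : ℝ, 0 ≤ E ∧ ∀ n : ℕ, N ≤ n → 1 ≤ n → ρ ^ (n - N) ≤ E / (n * √(n : ℝ)) := by
  obtain ⟨E₀, hE₀⟩ := (tendsto_pow_const_mul_const_pow_of_abs_lt_one 2
    (by rwa [abs_of_nonneg h0] : |ρ| < 1)).bddAbove_range
  have hE : ∀ m : ℕ, (m : ℝ) ^ 2 * ρ ^ m ≤ E₀ := fun m => hE₀ ⟨m, rfl⟩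
  have hE0 : 0 ≤ E₀ := le_trans (by positivity) (hE 0)
  refine ⟨2 * E₀ + 2 * (N : ℝ) ^ 2, by positivity, fun n hn hn1 => ?_⟩
  have hn1' : (1 : ℝ) ≤ n := by exact_mod_cast hn1
  rw [le_div_iff₀ (by positivity)]
  obtain ⟨m, rfl⟩ := Nat.exists_eq_add_of_le hn
  simp only [Nat.add_sub_cancel_left]
  have hs : √((N + m : ℕ) : ℝ) ≤ ((N + m : ℕ) : ℝ) := Real.sqrt_le_iff.2 ⟨by positivity, by nlinarith⟩
  have hp : ρ ^ m ≤ 1 := pow_le_one₀ h0 h1.le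
  have hp0 : 0 ≤ ρ ^ m := pow_nonneg h0 m
  calc _ ≤ ρ ^ m * (((N + m : ℕ) : ℝ) * ((N + m : ℕ) : ℝ)) := by gcongr
    _ ≤ ρ ^ m * (2 * (m : ℝ) ^ 2 + 2 * (N : ℝ) ^ 2) := by
        gcongr
        push_cast
        nlinarith [sq_nonneg ((N : ℝ) - m)]
    _ = 2 * ((m : ℝ) ^ 2 * ρ ^ m) + 2 * (N : ℝ) ^ 2 * ρ ^ m := by ring
    _ ≤ _ := by
        have := hE m
        have : 2 * (N : ℝ) ^ 2 * ρ ^ m ≤ 2 * (N : ℝ) ^ 2 * 1 := by gcongr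
        linarith

theorem sq_le_exp_div_eight {y : ℝ} (hy : 0 ≤ y) : y ^ 2 ≤ 128 * Real.exp (y / 8) := by
  have := Real.pow_div_factorial_le_exp (x := y / 8) (by positivity) 2
  norm_num [div_pow] at this
  linarith

theorem cube_le_exp_div_sixteen {y : ℝ} (hy : 0 ≤ y) : y ^ 3 ≤ 24576 * Real.exp (y / 16) := by
  have := Real.pow_div_factorial_le_exp (x := y / 16) (by positivity) 3
  norm_num [div_pow, Nat.factorial] at this
  linarith

theorem integrable_pow_mul_exp_neg_mul_sq {b : ℝ} (hb : 0 < b) (k : ℕ) :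
    Integrable (fun t : ℝ => t ^ k * Real.exp (-b * t ^ 2)) := by
  have hk : (-1 : ℝ) < k := lt_of_lt_of_le (by norm_num) (Nat.cast_nonneg k)
  simpa [Real.rpow_natCast] using integrable_rpow_mul_exp_neg_mul_sq hb hk

theorem integral_cube_mul_exp_neg_mul_sq (b : ℝ) :
    ∫ t : ℝ, t ^ 3 * Real.exp (-b * t ^ 2) = 0 := by
  have h := integral_neg_eq_self (fun t : ℝ => t ^ 3 * Real.exp (-b * t ^ 2)) volume
  have h2 : (fun t : ℝ => (-t) ^ 3 * Real.exp (-b * (-t) ^ 2)) =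
      fun t => -(t ^ 3 * Real.exp (-b * t ^ 2)) := by
    ext t; rw [neg_sq]; ring
  rw [h2, integral_neg] at h
  linarith

/-- Near the origin, the `n`-th power of `exp (-σ t² / 2 + c t³ + O(t⁴))` is a Gaussian with a
cubic correction, up to a relative error `O(1/n)`. -/
theorem norm_exp_pow_sub_le {A δ σ t : ℝ} {c r : ℂ} {n : ℕ} (hA : 0 ≤ A)
    (hAδ : A * δ * (1 + δ) ≤ 1 / 16) (hn : 1 ≤ n) (hσ : 1 / 2 ≤ σ) (hc : ‖c‖ ≤ A)
    (ht : |t| ≤ δ) (hr : ‖r‖ ≤ A * t ^ 4) :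
    ‖Complex.exp (-(σ / 2 * t ^ 2 : ℝ) + c * t ^ 3 + r) ^ n -
        ((Real.exp (-(n * σ / 2) * t ^ 2) : ℝ) : ℂ) * (1 + n * c * t ^ 3)‖ ≤
      (24576 * (A * (1 + δ)) ^ 2 + 128 * A) / n * Real.exp (-(n / 8 : ℝ) * t ^ 2) := by
  have hn' : (1 : ℝ) ≤ n := by exact_mod_cast hn
  have hn0 : (0 : ℝ) < n := by linarith
  have hδ : 0 ≤ δ := (abs_nonneg t).trans ht
  set y : ℝ := n * t ^ 2 with hy
  have hy0 : 0 ≤ y := by positivity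
  set w : ℂ := n * (c * t ^ 3 + r) with hw
  have habs : |t| ^ 2 = t ^ 2 := sq_abs t
  have hw1 : ‖w‖ ≤ n * (A * (1 + δ) * |t| ^ 3) := by
    rw [hw, norm_mul, Complex.norm_natCast]
    gcongr
    calc ‖c * t ^ 3 + r‖ ≤ ‖c‖ * |t| ^ 3 + ‖r‖ := by
          refine (norm_add_le _ _).trans ?_
          simp
      _ ≤ A * |t| ^ 3 + A * t ^ 4 := by gcongr
      _ = A * |t| ^ 3 + A * (|t| * |t| ^ 3) := by
          congr 2; rw [show t ^ 4 = (t ^ 2) ^ 2 by ring, ← habs]; ring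
      _ ≤ A * |t| ^ 3 + A * (δ * |t| ^ 3) := by gcongr
      _ = _ := by ring
  have hw2 : ‖w‖ ≤ y / 16 := by
    calc _ ≤ n * (A * (1 + δ) * |t| ^ 3) := hw1
      _ = n * |t| ^ 2 * (A * |t| * (1 + δ)) := by ring
      _ ≤ n * |t| ^ 2 * (A * δ * (1 + δ)) := by gcongr
      _ ≤ n * |t| ^ 2 * (1 / 16) := by gcongr
      _ = _ := by rw [habs]; ring
  have hw3 : ‖w‖ ^ 2 ≤ (A * (1 + δ)) ^ 2 * y ^ 3 / n := by
    calc _ ≤ (n * (A * (1 + δ) * |t| ^ 3)) ^ 2 := by gcongr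
      _ = (A * (1 + δ)) ^ 2 * (n * |t| ^ 2) ^ 3 / n := by field_simp
      _ = _ := by rw [habs]
  have e1 : Complex.exp (-(σ / 2 * t ^ 2 : ℝ) + c * t ^ 3 + r) ^ n =
      ((Real.exp (-(n * σ / 2) * t ^ 2) : ℝ) : ℂ) * Complex.exp w := by
    rw [← Complex.exp_nat_mul, Complex.ofReal_exp, ← Complex.exp_add]
    congr 1
    push_cast
    rw [hw]; ring
  have e2 : ‖Complex.exp w - (1 + n * c * t ^ 3)‖ ≤
      ‖w‖ ^ 2 * Real.exp ‖w‖ + A * y ^ 2 / n := by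
    have h1 := Complex.norm_exp_sub_sum_le_norm_mul_exp w 2
    simp only [Finset.sum_range_succ, Finset.range_zero, Finset.sum_empty, pow_zero,
      Nat.factorial, Nat.cast_one, div_one, zero_add, pow_one, mul_one] at h1
    calc _ = ‖(Complex.exp w - (1 + w)) + n * r‖ := by congr 1; rw [hw]; ring
      _ ≤ ‖Complex.exp w - (1 + w)‖ + n * ‖r‖ := by
        refine (norm_add_le _ _).trans ?_
        simp
      _ ≤ ‖w‖ ^ 2 * Real.exp ‖w‖ + n * (A * t ^ 4) := by gcongr
      _ = _ := by
        congr 1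
        rw [hy]
        field_simp
  rw [e1, ← mul_sub, norm_mul, Complex.norm_real, Real.norm_of_nonneg (Real.exp_pos _).le]
  have hg : Real.exp (-(n * σ / 2) * t ^ 2) ≤ Real.exp (-(y / 4)) := by
    apply Real.exp_le_exp.2
    rw [hy]
    nlinarith [mul_nonneg hn0.le (sq_nonneg t)]
  have h3 := cube_le_exp_div_sixteen hy0
  have h2 := sq_le_exp_div_eight hy0
  calc _ ≤ Real.exp (-(y / 4)) * (‖w‖ ^ 2 * Real.exp ‖w‖ + A * y ^ 2 / n) := by gcongr
    _ ≤ Real.exp (-(y / 4)) * ((A * (1 + δ)) ^ 2 * (24576 * Real.exp (y / 16)) / n *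
          Real.exp (y / 16) + A * (128 * Real.exp (y / 8)) / n) := by
        gcongr
        exact hw3.trans (by gcongr)
    _ = (24576 * (A * (1 + δ)) ^ 2 + 128 * A) / n *
          (Real.exp (-(y / 4)) * Real.exp (y / 8)) := by
        have : Real.exp (y / 8) = Real.exp (y / 16) * Real.exp (y / 16) := by
          rw [← Real.exp_add]; congr 1; ring
        rw [this]; ring
    _ = _ := by
        rw [← Real.exp_add]
        congr 2
        rw [hy]; ring

/-- Away from the origin the corrected Gaussian is negligible. -/
theorem norm_gaussian_tail_le {A δ σ t : ℝ} {c : ℂ} {n : ℕ} (hA : 0 ≤ A) (hδ : 0 < δ)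
    (hn : 1 ≤ n) (hσ : 1 / 2 ≤ σ) (hc : ‖c‖ ≤ A) (ht : δ < |t|) :
    ‖((Real.exp (-(n * σ / 2) * t ^ 2) : ℝ) : ℂ) * (1 + n * c * t ^ 3)‖ ≤
      (128 * (1 / δ ^ 4 + A / δ)) / n * Real.exp (-(n / 8 : ℝ) * t ^ 2) := by
  have hn' : (1 : ℝ) ≤ n := by exact_mod_cast hn
  have hn0 : (0 : ℝ) < n := by linarith
  set y : ℝ := n * t ^ 2 with hy
  have hy0 : 0 ≤ y := by positivity
  have habs : |t| ^ 2 = t ^ 2 := sq_abs t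
  have h4 : y ^ 2 = n ^ 2 * |t| ^ 4 := by rw [hy, ← habs]; ring
  have ht0 : 0 < |t| := hδ.trans ht
  have b1 : 1 ≤ 1 / δ ^ 4 * y ^ 2 / n := by
    rw [h4, show 1 / δ ^ 4 * ((n : ℝ) ^ 2 * |t| ^ 4) / n = n * (|t| / δ) ^ 4 by field_simp]
    have : 1 ≤ (|t| / δ) ^ 4 := one_le_pow₀ ((one_le_div hδ).2 ht.le)
    nlinarith
  have b2 : n * A * |t| ^ 3 ≤ A / δ * y ^ 2 / n := by
    rw [h4, show A / δ * ((n : ℝ) ^ 2 * |t| ^ 4) / n = n * A * |t| ^ 3 * (|t| / δ) by field_simp]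
    exact le_mul_of_one_le_right (by positivity) ((one_le_div hδ).2 ht.le)
  rw [norm_mul, Complex.norm_real, Real.norm_of_nonneg (Real.exp_pos _).le]
  have hg : Real.exp (-(n * σ / 2) * t ^ 2) ≤ Real.exp (-(y / 4)) := by
    apply Real.exp_le_exp.2
    rw [hy]
    nlinarith [mul_nonneg hn0.le (sq_nonneg t)]
  have h2 := sq_le_exp_div_eight hy0
  have h3 : ‖(1 : ℂ) + n * c * t ^ 3‖ ≤ (1 / δ ^ 4 + A / δ) * y ^ 2 / n := by
    calc _ ≤ 1 + n * ‖c‖ * |t| ^ 3 := by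
          refine (norm_add_le _ _).trans ?_
          simp
      _ ≤ 1 + n * A * |t| ^ 3 := by gcongr
      _ ≤ 1 / δ ^ 4 * y ^ 2 / n + A / δ * y ^ 2 / n := add_le_add b1 b2
      _ = _ := by ring
  calc _ ≤ Real.exp (-(y / 4)) * ((1 / δ ^ 4 + A / δ) * (128 * Real.exp (y / 8)) / n) := by
        gcongr
        exact h3.trans (by gcongr)
    _ = (128 * (1 / δ ^ 4 + A / δ)) / n * (Real.exp (-(y / 4)) * Real.exp (y / 8)) := by ring
    _ = _ := by
        rw [← Real.exp_add]
        congr 2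
        rw [hy]; ring

theorem integral_corrected_gaussian {a : ℝ} (ha : 0 < a) (c : ℂ) :
    Integrable (fun t : ℝ => ((Real.exp (-a * t ^ 2) : ℝ) : ℂ) * (1 + c * t ^ 3)) ∧
      ∫ t : ℝ, ((Real.exp (-a * t ^ 2) : ℝ) : ℂ) * (1 + c * t ^ 3) =
        ((√(Real.pi / a) : ℝ) : ℂ) := by
  have i1 : Integrable (fun t : ℝ => ((Real.exp (-a * t ^ 2) : ℝ) : ℂ)) :=
    (integrable_exp_neg_mul_sq ha).ofReal
  have i2 : Integrable (fun t : ℝ => c * ((t ^ 3 * Real.exp (-a * t ^ 2) : ℝ) : ℂ)) :=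
    ((integrable_pow_mul_exp_neg_mul_sq ha 3).ofReal).const_mul c
  have e : (fun t : ℝ => ((Real.exp (-a * t ^ 2) : ℝ) : ℂ) * (1 + c * t ^ 3)) =
      fun t : ℝ => ((Real.exp (-a * t ^ 2) : ℝ) : ℂ) + c * ((t ^ 3 * Real.exp (-a * t ^ 2) : ℝ) : ℂ) := by
    ext t; push_cast; ring
  rw [e]
  refine ⟨i1.add i2, ?_⟩
  rw [integral_add i1 i2, integral_const_mul, integral_complex_ofReal, integral_complex_ofReal,
    integral_cube_mul_exp_neg_mul_sq, integral_gaussian]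
  simp

/-- **Laplace's method.** If `F` is `exp (-σ t² / 2 + c t³ + O(t⁴))` near the origin, is bounded
by `ρ < 1` elsewhere, and has an integrable `N`-th power, then `∫ F ^ n` is `√(2π / (n σ))` up to
a relative error `O(1/n)` that is uniform in `F`; the cubic term contributes nothing at this order
because it is odd. -/
theorem exists_laplace_bound {A δ ρ J : ℝ} (N : ℕ) (hA : 0 ≤ A) (hδ : 0 < δ)
    (hAδ : A * δ * (1 + δ) ≤ 1 / 16) (hρ0 : 0 ≤ ρ) (hρ1 : ρ < 1) (hJ : 0 ≤ J) :
    ∃ C : ℝ, 0 ≤ C ∧ ∀ (F : ℝ → ℂ) (σ : ℝ) (c : ℂ) (R : ℝ → ℂ) (n : ℕ), N ≤ n → 1 ≤ n →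
      1 / 2 ≤ σ → ‖c‖ ≤ A →
      (∀ t, |t| ≤ δ → ‖R t‖ ≤ A * t ^ 4 ∧
        F t = Complex.exp (-(σ / 2 * t ^ 2 : ℝ) + c * t ^ 3 + R t)) →
      (∀ t, δ < |t| → ‖F t‖ ≤ ρ) → Continuous F → Integrable (fun t => ‖F t‖ ^ N) →
      ∫ t, ‖F t‖ ^ N ≤ J →
      ‖(∫ t, F t ^ n) - ((√(2 * Real.pi / (n * σ)) : ℝ) : ℂ)‖ ≤ C / (n * √(n : ℝ)) := by
  obtain ⟨E, hE0, hE⟩ := exists_pow_sub_le hρ0 hρ1 N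
  set D := (24576 * (A * (1 + δ)) ^ 2 + 128 * A) + 128 * (1 / δ ^ 4 + A / δ) with hD
  have hD0 : 0 ≤ D := by positivity
  refine ⟨D * √(8 * Real.pi) + E * J, by positivity, ?_⟩
  intro F σ c R n hN hn hσ hc hnear hfar hF hFi hFJ
  have hn' : (1 : ℝ) ≤ n := by exact_mod_cast hn
  have hn0 : (0 : ℝ) < n := by linarith
  have ha : 0 < n * σ / 2 := by positivity
  obtain ⟨hGi, hG⟩ := integral_corrected_gaussian ha (n * c)
  have hpt : ∀ t, ‖F t ^ n - ((Real.exp (-(n * σ / 2) * t ^ 2) : ℝ) : ℂ) * (1 + n * c * t ^ 3)‖ ≤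
      D / n * Real.exp (-(n / 8 : ℝ) * t ^ 2) + ρ ^ (n - N) * ‖F t‖ ^ N := by
    intro t
    rcases le_or_gt |t| δ with ht | ht
    · obtain ⟨hr, hFt⟩ := hnear t ht
      rw [hFt]
      refine (norm_exp_pow_sub_le hA hAδ hn hσ hc ht hr).trans ?_
      refine le_add_of_le_of_nonneg ?_ (by positivity)
      gcongr
      rw [hD]
      exact le_add_of_nonneg_right (by positivity)
    · refine (norm_sub_le _ _).trans ?_
      rw [add_comm]
      refine add_le_add ((norm_gaussian_tail_le hA hδ hn hσ hc ht).trans ?_) ?_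
      · gcongr
        rw [hD]
        exact le_add_of_nonneg_left (by positivity)
      · rw [norm_pow]
        calc ‖F t‖ ^ n = ‖F t‖ ^ (n - N) * ‖F t‖ ^ N := by
              rw [← pow_add, Nat.sub_add_cancel hN]
          _ ≤ _ := by gcongr; exact hfar t ht
  have hbi : Integrable (fun t : ℝ => D / n * Real.exp (-(n / 8 : ℝ) * t ^ 2) +
      ρ ^ (n - N) * ‖F t‖ ^ N) :=
    ((integrable_exp_neg_mul_sq (by positivity)).const_mul _).add (hFi.const_mul _)
  have hdi : Integrable (fun t : ℝ => F t ^ n -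
      ((Real.exp (-(n * σ / 2) * t ^ 2) : ℝ) : ℂ) * (1 + n * c * t ^ 3)) :=
    hbi.mono' (((hF.pow n).aestronglyMeasurable).sub hGi.aestronglyMeasurable) (ae_of_all _ hpt)
  have hFn : Integrable (fun t => F t ^ n) := by
    have := hdi.add hGi
    refine this.congr (ae_of_all _ fun t => ?_)
    simp
  have hval : √(2 * Real.pi / (n * σ)) = √(Real.pi / (n * σ / 2)) := by
    congr 1; field_simp
  rw [hval, ← hG, ← integral_sub hFn hGi]
  refine (norm_integral_le_integral_norm _).trans ?_
  calc _ ≤ ∫ t : ℝ, (D / n * Real.exp (-(n / 8 : ℝ) * t ^ 2) + ρ ^ (n - N) * ‖F t‖ ^ N) :=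
        integral_mono hdi.norm hbi hpt
    _ = D / n * √(Real.pi / (n / 8)) + ρ ^ (n - N) * ∫ t, ‖F t‖ ^ N := by
        rw [integral_add ((integrable_exp_neg_mul_sq (by positivity)).const_mul _)
          (hFi.const_mul _), integral_const_mul, integral_const_mul, integral_gaussian]
    _ ≤ D / n * √(Real.pi / (n / 8)) + E / (n * √(n : ℝ)) * J := by
        gcongr
        exact hE n hN hn
    _ = _ := by
        rw [show Real.pi / (n / 8 : ℝ) = 8 * Real.pi / n by field_simp,
          Real.sqrt_div (by positivity)]
        field_simp

/-! ### Sums of independent identically distributed variables -/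

section Sums

variable {Ω : Type*} [MeasurableSpace Ω] {P : Measure Ω} {X : ℕ → Ω → ℝ}

theorem charFun_map_sum_range (hindep : iIndepFun X P)
    (hident : ∀ i, IdentDistrib (X i) (X 0) P P) (n : ℕ) :
    charFun (P.map (fun ω => ∑ i ∈ Finset.range n, X i ω)) = charFun (P.map (X 0)) ^ n := by
  rw [iIndepFun.charFun_map_fun_finsetSum_eq_prod (fun i _ => (hident i).aemeasurable_fst)
    (hindep.restrict _)]
  simp [fun i => (hident i).map_eq]

theorem complexMGF_sum_range (hindep : iIndepFun X P)
    (hident : ∀ i, IdentDistrib (X i) (X 0) P P) (n : ℕ) (z : ℂ) :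
    complexMGF id (P.map (fun ω => ∑ i ∈ Finset.range n, X i ω)) z =
      complexMGF (X 0) P z ^ n := by
  have hm : ∀ i, AEMeasurable (X i) P := fun i => (hident i).aemeasurable_fst
  rw [complexMGF_id_map (Finset.aemeasurable_fun_sum _ fun i _ => hm i)]
  have hfin : iIndepFun (fun i : Fin n => X i) P :=
    hindep.precomp (g := fun i : Fin n => (i : ℕ)) Fin.val_injective
  have h := hfin.integral_fun_prod_comp (𝕜 := ℂ)
    (f := fun _ (x : ℝ) => Complex.exp (z * x))
    (fun i => hm i) (fun i => by fun_prop)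
  have h2 : ∀ i : Fin n, ∫ ω, Complex.exp (z * X i ω) ∂P = complexMGF (X 0) P z := fun i =>
    congrFun (complexMGF_congr_identDistrib (hident i)) z
  simp only [h2, Finset.prod_const, Finset.card_univ, Fintype.card_fin] at h
  rw [← h, complexMGF]
  congr with ω
  rw [← Complex.exp_sum, Finset.sum_range, Complex.ofReal_sum, Finset.mul_sum]

theorem map_sum_range_add [IsProbabilityMeasure P] (hindep : iIndepFun X P)
    (hident : ∀ i, IdentDistrib (X i) (X 0) P P) (m k : ℕ) :
    P.map (fun ω => ∑ i ∈ Finset.range (m + k), X i ω) =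
      (P.map (fun ω => ∑ i ∈ Finset.range m, X i ω)) ∗
        (P.map (fun ω => ∑ i ∈ Finset.range k, X i ω)) := by
  have hp : ∀ n, IsProbabilityMeasure (P.map (fun ω => ∑ i ∈ Finset.range n, X i ω)) := fun n =>
    Measure.isProbabilityMeasure_map
      (Finset.aemeasurable_fun_sum _ fun i _ => (hident i).aemeasurable_fst)
  have := hp m
  have := hp k
  have := hp (m + k)
  apply Measure.ext_of_charFun
  ext t
  rw [charFun_conv, charFun_map_sum_range hindep hident, charFun_map_sum_range hindep hident,
    charFun_map_sum_range hindep hident, pow_add, Pi.mul_apply]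

end Sums

/-! ### Densities of sums and of tilted laws -/

section Density

variable {ν : Measure ℝ} {q : ℝ → ℝ}

theorem IsDensity.integral_eq {E : Type*} [NormedAddCommGroup E] [NormedSpace ℝ E]
    (h : IsDensity ν q) (g : ℝ → E) : ∫ x, g x ∂ν = ∫ x, q x • g x := by
  rw [h.eq_withDensity, integral_withDensity_eq_integral_toReal_smul
    h.measurable.ennreal_ofReal (by simp)]
  simp [fun x => ENNReal.toReal_ofReal (h.nonneg x)]

theorem IsDensity.integrable_iff {E : Type*} [NormedAddCommGroup E] [NormedSpace ℝ E]
    (h : IsDensity ν q) {g : ℝ → E} : Integrable g ν ↔ Integrable (fun x => q x • g x) := by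
  rw [h.eq_withDensity, integrable_withDensity_iff_integrable_smul'
    h.measurable.ennreal_ofReal (by simp)]
  simp [fun x => ENNReal.toReal_ofReal (h.nonneg x)]

theorem IsDensity.map_mul_left (h : IsDensity ν q) {c : ℝ} (hc : 0 < c) :
    IsDensity (ν.map (fun x => c * x)) (fun x => c⁻¹ * q (c⁻¹ * x)) where
  measurable := (h.measurable.comp (measurable_const_mul _)).const_mul _
  nonneg x := mul_nonneg (inv_pos.2 hc).le (h.nonneg _)
  eq_withDensity := by
    apply Measure.ext_of_lintegral
    intro φ hφ
    have hq := h.measurable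
    rw [lintegral_map hφ (by fun_prop), h.eq_withDensity,
      lintegral_withDensity_eq_lintegral_mul _ (by fun_prop) (by fun_prop),
      lintegral_withDensity_eq_lintegral_mul _ (by fun_prop) (by fun_prop)]
    have hs := Real.smul_map_volume_mul_left hc.ne'
    conv_rhs => rw [← hs]
    rw [lintegral_smul_measure, lintegral_map (by fun_prop) (by fun_prop), smul_eq_mul,
      ← lintegral_const_mul _ (by fun_prop)]
    congr with x
    simp only [Pi.mul_apply]
    rw [inv_mul_cancel_left₀ hc.ne', ENNReal.ofReal_mul (inv_pos.2 hc).le, ← mul_assoc,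
      ← mul_assoc, ← ENNReal.ofReal_mul (abs_nonneg c), abs_of_pos hc, mul_inv_cancel₀ hc.ne']
    simp

theorem IsDensity.conv (h : IsDensity ν q) {M : ℝ} (hM : ∀ x, q x ≤ M) (κ : Measure ℝ)
    [IsProbabilityMeasure κ] :
    IsDensity (ν ∗ κ) (fun s => ∫ y, q (s - y) ∂κ) ∧ ∀ s, ∫ y, q (s - y) ∂κ ≤ M := by
  have hq := h.measurable
  have hi : ∀ s, Integrable (fun y => q (s - y)) κ := fun s =>
    Integrable.of_bound (C := M)
      (hq.comp (measurable_const.sub measurable_id)).aestronglyMeasurable (ae_of_all _ fun y => by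
      rw [Real.norm_of_nonneg (h.nonneg _)]; exact hM _)
  refine ⟨⟨?_, fun s => integral_nonneg fun y => h.nonneg _, ?_⟩, fun s => ?_⟩
  · exact (StronglyMeasurable.integral_prod_right (f := fun s y => q (s - y))
      (by fun_prop : Measurable _).stronglyMeasurable).measurable
  · have hsf : SFinite ν := by rw [h.eq_withDensity]; infer_instance
    apply Measure.ext_of_lintegral
    intro φ hφ
    have e : ∀ s, ENNReal.ofReal (∫ y, q (s - y) ∂κ) = ∫⁻ y, ENNReal.ofReal (q (s - y)) ∂κ :=
      fun s => ofReal_integral_eq_lintegral_ofReal (hi s) (ae_of_all _ fun y => h.nonneg _)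
    simp only [e]
    have hme : Measurable (fun s => ∫⁻ y, ENNReal.ofReal (q (s - y)) ∂κ) :=
      Measurable.lintegral_prod_right (f := fun s y => ENNReal.ofReal (q (s - y)))
        (by fun_prop)
    rw [Measure.lintegral_conv hφ, lintegral_withDensity_eq_lintegral_mul _ hme hφ,
      lintegral_lintegral_swap (by fun_prop)]
    have e2 : ∀ y, ∫⁻ x, φ (x + y) ∂ν = ∫⁻ x, ENNReal.ofReal (q (x - y)) * φ x := by
      intro y
      rw [h.eq_withDensity, lintegral_withDensity_eq_lintegral_mul _ (by fun_prop) (by fun_prop),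
        ← lintegral_sub_right_eq_self _ y]
      simp
    simp only [e2, Pi.mul_apply]
    rw [lintegral_lintegral_swap (by fun_prop)]
    congr with x
    rw [lintegral_mul_const _ (by fun_prop)]
  · calc _ ≤ ∫ _, M ∂κ := integral_mono (hi s) (integrable_const M) fun y => hM _
      _ = M := by simp

theorem IsDensity.integrable [IsFiniteMeasure ν] (h : IsDensity ν q) : Integrable q := by
  have := h.integrable_iff.1 (integrable_const (1 : ℝ))
  simpa using this

/-- The exponentially tilted density `e^{hx} q(x)`; it is not normalized. -/
noncomputable def tiltedDensity (q : ℝ → ℝ) (h : ℝ) (x : ℝ) : ℂ :=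
  ((q x * Real.exp (h * x) : ℝ) : ℂ)

theorem IsDensity.integrable_tiltedDensity (hq : IsDensity ν q) {h : ℝ}
    (hexp : Integrable (fun x => Real.exp (h * x)) ν) : Integrable (tiltedDensity q h) :=
  (hq.integrable_iff.1 hexp).ofReal

theorem IsDensity.fourier_tiltedDensity (hq : IsDensity ν q) (h ξ : ℝ) :
    FourierTransform.fourier (tiltedDensity q h) ξ =
      complexMGF id ν (h + (-(2 * Real.pi) * ξ : ℝ) * Complex.I) := by
  rw [Real.fourier_real_eq_integral_exp_smul, complexMGF, hq.integral_eq]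
  congr with x
  simp only [tiltedDensity, Complex.ofReal_mul, Complex.ofReal_exp, smul_eq_mul, Complex.real_smul,
    id]
  rw [mul_left_comm, ← Complex.exp_add]
  congr 2
  push_cast
  ring

/-- Plancherel's formula for a tilted density: square integrability of the moment generating
function along vertical lines. -/
theorem IsDensity.integral_norm_sq_complexMGF_le [IsFiniteMeasure ν] (hq : IsDensity ν q) {M h : ℝ}
    (hM : ∀ x, q x ≤ M) (hexp : Integrable (fun x => Real.exp (h * x)) ν)
    (hexp2 : Integrable (fun x => Real.exp (2 * h * x)) ν) :
    Integrable (fun t : ℝ => ‖complexMGF id ν (h + t * Complex.I)‖ ^ 2) ∧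
      ∫ t : ℝ, ‖complexMGF id ν (h + t * Complex.I)‖ ^ 2 ≤
        2 * Real.pi * (M * ∫ x, Real.exp (2 * h * x) ∂ν) := by
  have hmeas := hq.measurable
  have hsq : ∀ x, ‖tiltedDensity q h x‖ ^ 2 ≤ M * (q x • Real.exp (2 * h * x)) := by
    intro x
    rw [tiltedDensity, Complex.norm_real, Real.norm_eq_abs, sq_abs, mul_pow, smul_eq_mul,
      ← Real.exp_nat_mul]
    have : Real.exp ((2 : ℕ) * (h * x)) = Real.exp (2 * h * x) := by congr 1; push_cast; ring
    rw [this, sq, ← mul_assoc]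
    gcongr
    · exact hq.nonneg x
    · exact hM x
  have hi2 : Integrable (fun x => M * (q x • Real.exp (2 * h * x))) :=
    (hq.integrable_iff.1 hexp2).const_mul M
  have hu := hq.integrable_tiltedDensity hexp
  have husq : Integrable (fun x => ‖tiltedDensity q h x‖ ^ 2) :=
    hi2.mono' (hu.aestronglyMeasurable.norm.pow 2) (ae_of_all _ fun x => by
      rw [Real.norm_of_nonneg (by positivity)]; exact hsq x)
  obtain ⟨h1, h2⟩ := integral_norm_sq_fourier hu
    ((memLp_two_iff_integrable_sq_norm hu.aestronglyMeasurable).2 husq)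
  simp only [hq.fourier_tiltedDensity] at h1 h2
  have hpi : -(2 * Real.pi) ≠ 0 := by have := Real.pi_pos; linarith [neg_neg_of_pos this]
  refine ⟨(integrable_comp_mul_left_iff
    (fun t : ℝ => ‖complexMGF id ν (h + t * Complex.I)‖ ^ 2) hpi).1 h1, ?_⟩
  have h3 := Measure.integral_comp_mul_left
    (fun t : ℝ => ‖complexMGF id ν (h + t * Complex.I)‖ ^ 2) (-(2 * Real.pi))
  rw [h2, abs_inv, abs_neg, abs_of_pos Real.two_pi_pos, smul_eq_mul,
    eq_inv_mul_iff_mul_eq₀ Real.two_pi_pos.ne'] at h3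
  rw [← h3]
  gcongr
  rw [hq.integral_eq, ← integral_const_mul]
  exact integral_mono husq hi2 hsq

/-- Fourier inversion for a tilted continuous density. -/
theorem IsDensity.mul_exp_eq_integral_complexMGF [IsFiniteMeasure ν] (hq : IsDensity ν q)
    (hc : Continuous q) {h : ℝ} (hexp : Integrable (fun x => Real.exp (h * x)) ν)
    (hi : Integrable (fun t : ℝ => complexMGF id ν (h + t * Complex.I))) (s : ℝ) :
    ((q s * Real.exp (h * s) : ℝ) : ℂ) = (2 * Real.pi : ℝ)⁻¹ *
      ∫ t : ℝ, complexMGF id ν (h + t * Complex.I) * Complex.exp (-(t * s * Complex.I)) := by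
  have hpi : -(2 * Real.pi) ≠ 0 := by have := Real.pi_pos; linarith [neg_neg_of_pos this]
  have hu := hq.integrable_tiltedDensity hexp
  have huc : Continuous (tiltedDensity q h) := by unfold tiltedDensity; fun_prop
  have hfi : Integrable (FourierTransform.fourier (tiltedDensity q h)) := by
    have := (integrable_comp_mul_left_iff
      (fun t : ℝ => complexMGF id ν (h + t * Complex.I)) hpi).2 hi
    exact this.congr (ae_of_all _ fun ξ => (hq.fourier_tiltedDensity h ξ).symm)
  have h1 := congrFun (huc.fourierInv_fourier_eq hu hfi) s
  rw [Real.fourierInv_eq'] at h1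
  simp only [hq.fourier_tiltedDensity, smul_eq_mul] at h1
  have h3 := Measure.integral_comp_mul_left
    (fun t : ℝ => complexMGF id ν (h + t * Complex.I) * Complex.exp (-(t * s * Complex.I)))
    (-(2 * Real.pi))
  rw [abs_inv, abs_neg, abs_of_pos Real.two_pi_pos, Complex.real_smul] at h3
  rw [← h3, ← tiltedDensity, ← h1]
  congr with ξ
  rw [mul_comm]
  congr 2
  simp
  ring

end Density

theorem exists_continuous_density_sum {Ω : Type*} [MeasurableSpace Ω] {P : Measure Ω}
    [IsProbabilityMeasure P] {X : ℕ → Ω → ℝ} (hindep : iIndepFun X P)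
    (hident : ∀ i, IdentDistrib (X i) (X 0) P P) {f : ℝ → ℝ} {M : ℝ} {n₀ n : ℕ}
    (hf : IsDensity (P.map (fun ω => ∑ i ∈ Finset.range n₀, X i ω)) f) (hM : ∀ x, f x ≤ M)
    (hn : 2 * n₀ ≤ n) :
    ∃ p : ℝ → ℝ, IsDensity (P.map (fun ω => ∑ i ∈ Finset.range n, X i ω)) p ∧ Continuous p ∧
      ∀ x, p x ≤ M := by
  have hp : ∀ n, IsProbabilityMeasure (P.map (fun ω => ∑ i ∈ Finset.range n, X i ω)) := fun n =>
    Measure.isProbabilityMeasure_map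
      (Finset.aemeasurable_fun_sum _ fun i _ => (hident i).aemeasurable_fst)
  obtain ⟨k, rfl⟩ := Nat.exists_eq_add_of_le hn
  have := hp k
  have := hp (n₀ + k)
  have := hp n₀
  have h1 := hf.conv hM (P.map (fun ω => ∑ i ∈ Finset.range k, X i ω))
  rw [← map_sum_range_add hindep hident] at h1
  have h2 := hf.conv hM (P.map (fun ω => ∑ i ∈ Finset.range (n₀ + k), X i ω))
  rw [← map_sum_range_add hindep hident, ← add_assoc, ← two_mul] at h2
  refine ⟨_, h2.1, ?_, h2.2⟩
  set g := fun s => ∫ y, f (s - y) ∂(P.map (fun ω => ∑ i ∈ Finset.range k, X i ω))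
  have e : (fun s => ∫ y, f (s - y) ∂(P.map (fun ω => ∑ i ∈ Finset.range (n₀ + k), X i ω))) =
      fun s => ∫ y, f (s - y) * g y := by
    ext s
    rw [h1.1.integral_eq]
    simp only [smul_eq_mul, mul_comm]
  rw [e]
  exact continuous_integral_sub_mul hf.integrable h1.1.measurable (M := M) fun y => by
    rw [abs_of_nonneg (h1.1.nonneg y)]
    exact h1.2 y

/-! ### Decay of the moment generating function along vertical lines -/

/-- The characteristic function of an absolutely continuous law vanishes at infinity, by the
Riemann–Lebesgue lemma. -/
theorem IsDensity.tendsto_charFun {ν : Measure ℝ} [IsFiniteMeasure ν] {q : ℝ → ℝ}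
    (hq : IsDensity ν q) :
    Filter.Tendsto (charFun ν) (Filter.cocompact ℝ) (𝓝 0) := by
  have h1 := Real.zero_at_infty_fourier (tiltedDensity q 0)
  have h2 : charFun ν = FourierTransform.fourier (tiltedDensity q 0) ∘
      (Homeomorph.mulLeft₀ (-(2 * Real.pi))⁻¹ (by simp)) := by
    ext t
    simp only [Function.comp_apply, hq.fourier_tiltedDensity, Homeomorph.coe_mulLeft₀]
    rw [mul_inv_cancel_left₀ (by simp), ← complexMGF_id_mul_I]
    simp
  rw [h2]
  exact h1.comp (Homeomorph.isClosedEmbedding _).tendsto_cocompact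

/-- If some power of a characteristic function vanishes at infinity, its modulus is `< 1` off the
origin: otherwise `e^{itX}` is almost surely constant, and the modulus is `1` at all multiples
of `t`. -/
theorem norm_charFun_lt_one {ν : Measure ℝ} [IsProbabilityMeasure ν] {N : ℕ}
    (h : Filter.Tendsto (fun t => charFun ν t ^ N) (Filter.cocompact ℝ) (𝓝 0)) {t : ℝ}
    (ht : t ≠ 0) : ‖charFun ν t‖ < 1 := by
  have hn : ∀ x : ℝ, ‖Complex.exp (t * x * Complex.I)‖ = 1 := fun x => by
    rw [← Complex.ofReal_mul, Complex.norm_exp_ofReal_mul_I]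
  rcases ae_eq_const_or_norm_integral_lt_of_norm_le_const (μ := ν) (C := 1)
    (f := fun x : ℝ => Complex.exp (t * x * Complex.I)) (ae_of_all _ fun x => (hn x).le) with h1 | h1
  · exfalso
    set c := ⨍ x : ℝ, Complex.exp (t * x * Complex.I) ∂ν
    have hc : ‖c‖ = 1 := by
      obtain ⟨x, hx⟩ := h1.exists
      rw [← hn x]
      exact congrArg norm hx.symm
    have hk : ∀ k : ℕ, charFun ν (k * t) = c ^ k := by
      intro k
      rw [charFun_apply_real]
      calc _ = ∫ _, c ^ k ∂ν := by
            apply integral_congr_ae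
            filter_upwards [h1] with x hx
            have hx' : Complex.exp (t * x * Complex.I) = c := hx
            rw [← hx', ← Complex.exp_nat_mul]
            congr 1
            push_cast
            ring
        _ = c ^ k := by simp
    have h2 : Filter.Tendsto (fun k : ℕ => (k : ℝ) * t) Filter.atTop (Filter.cocompact ℝ) := by
      rw [← Metric.cobounded_eq_cocompact, ← tendsto_norm_atTop_iff_cobounded]
      simp only [norm_mul, Real.norm_natCast]
      exact tendsto_natCast_atTop_atTop.atTop_mul_const (by simpa using ht)
    have h3 := (h.comp h2).norm
    simp only [Function.comp_apply, hk, norm_pow, hc, one_pow, norm_zero] at h3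
    exact one_ne_zero (tendsto_nhds_unique tendsto_const_nhds h3)
  · rw [charFun_apply_real]
    simpa using h1

theorem exists_norm_charFun_le {ν : Measure ℝ} [IsProbabilityMeasure ν] {N : ℕ}
    (h : Filter.Tendsto (fun t => charFun ν t ^ N) (Filter.cocompact ℝ) (𝓝 0)) {δ : ℝ}
    (hδ : 0 < δ) : ∃ ρ : ℝ, 0 ≤ ρ ∧ ρ < 1 ∧ ∀ t, δ ≤ |t| → ‖charFun ν t‖ ≤ ρ := by
  have h0 : Filter.Tendsto (fun t => ‖charFun ν t‖ ^ N) (Filter.cocompact ℝ) (𝓝 0) := by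
    simpa using h.norm
  have h1 : ∀ᶠ t in Filter.cocompact ℝ, ‖charFun ν t‖ ^ N < (1 / 2) ^ N :=
    h0.eventually_lt_const (by positivity)
  rw [← Metric.cobounded_eq_cocompact, Filter.Eventually,
    Metric.hasBasis_cobounded_compl_closedBall (0 : ℝ) |>.mem_iff] at h1
  obtain ⟨T, -, hT⟩ := h1
  set s : Set ℝ := Metric.closedBall 0 (max T δ) ∩ {t | δ ≤ |t|} with hs
  have hsc : IsCompact s :=
    (isCompact_closedBall _ _).inter_right (isClosed_le continuous_const continuous_abs)
  have hcont : Continuous (charFun ν) := by fun_prop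
  obtain ⟨t₀, ht₀, hmax⟩ := hsc.exists_isMaxOn
    ⟨δ, by simp [hs, abs_of_pos hδ]⟩ hcont.norm.continuousOn
  have hlt : ‖charFun ν t₀‖ < 1 := norm_charFun_lt_one h (by
    rintro rfl
    have := ht₀.2
    simp only [Set.mem_ofPred_eq, abs_zero] at this
    linarith)
  refine ⟨max ‖charFun ν t₀‖ (1 / 2), le_max_of_le_right (by norm_num),
    max_lt hlt (by norm_num), fun t ht => ?_⟩
  by_cases htT : t ∈ s
  · exact le_max_of_le_left (hmax htT)
  · apply le_max_of_le_right
    have h2 : t ∈ (Metric.closedBall (0 : ℝ) T)ᶜ := fun hmem =>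
      htT ⟨Metric.closedBall_subset_closedBall (le_max_left _ _) hmem, ht⟩
    have h3 : ‖charFun ν t‖ ^ N < (1 / 2) ^ N := hT h2
    exact (lt_of_pow_lt_pow_left₀ N (by norm_num) h3).le

section Tilt

variable {Ω : Type*} [MeasurableSpace Ω] {P : Measure Ω} {X : Ω → ℝ} {b : ℝ}

theorem integrable_exp_mul_of_abs_le (hX : AEMeasurable X P)
    (hexp : Integrable (fun ω => Real.exp (b * |X ω|)) P) {h : ℝ} (hh : |h| ≤ b) :
    Integrable (fun ω => Real.exp (h * X ω)) P := by
  refine hexp.mono' (by fun_prop) (ae_of_all _ fun ω => ?_)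
  rw [Real.norm_of_nonneg (Real.exp_pos _).le]
  apply Real.exp_le_exp.2
  calc h * X ω ≤ |h * X ω| := le_abs_self _
    _ = |h| * |X ω| := abs_mul _ _
    _ ≤ _ := by gcongr

theorem norm_complexMGF_sub_le (hX : AEMeasurable X P) (hb : 0 < b)
    (hexp : Integrable (fun ω => Real.exp (b * |X ω|)) P) {h : ℝ} (hh : |h| ≤ b / 2) (t : ℝ) :
    ‖complexMGF X P (h + t * Complex.I) - complexMGF X P (t * Complex.I)‖ ≤
      |h| * (2 / b * ∫ ω, Real.exp (b * |X ω|) ∂P) := by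
  have hi : ∀ h : ℝ, |h| ≤ b →
      Integrable (fun ω => Complex.exp ((h + t * Complex.I) * X ω)) P := by
    intro h hh
    rw [← integrable_norm_iff (by fun_prop)]
    refine (integrable_exp_mul_of_abs_le hX hexp hh).congr (ae_of_all _ fun ω => ?_)
    simp [Complex.norm_exp]
  have h1 := hi h (by linarith)
  have h2 := hi 0 (by simpa using hb.le)
  simp only [Complex.ofReal_zero, zero_add] at h2
  rw [complexMGF, complexMGF, ← integral_sub h1 h2, ← integral_const_mul, ← integral_const_mul]
  apply norm_integral_le_of_norm_le ((hexp.const_mul _).const_mul _)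
  refine ae_of_all _ fun ω => ?_
  set x := X ω
  have e : Complex.exp ((h + t * Complex.I) * x) - Complex.exp (t * Complex.I * x) =
      Complex.exp ((t * x : ℝ) * Complex.I) * (Complex.exp ((h * x : ℝ)) - 1) := by
    rw [mul_sub, ← Complex.exp_add, mul_one]
    congr 2 <;> push_cast <;> ring
  rw [e, norm_mul, Complex.norm_exp_ofReal_mul_I, one_mul]
  have h3 := Complex.norm_exp_sub_sum_le_norm_mul_exp ((h * x : ℝ) : ℂ) 1
  simp only [Finset.range_one, Finset.sum_singleton, pow_zero, Nat.factorial_zero, Nat.cast_one,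
    div_one, pow_one, Complex.norm_real, Real.norm_eq_abs, abs_mul] at h3
  refine h3.trans ?_
  have h4 : |x| ≤ 2 / b * Real.exp (b / 2 * |x|) := by
    have := Real.add_one_le_exp (b / 2 * |x|)
    rw [div_mul_eq_mul_div, le_div_iff₀ hb]
    linarith
  calc |h| * |x| * Real.exp (|h| * |x|)
      ≤ |h| * (2 / b * Real.exp (b / 2 * |x|)) * Real.exp (b / 2 * |x|) := by gcongr
    _ = |h| * (2 / b * (Real.exp (b / 2 * |x|) * Real.exp (b / 2 * |x|))) := by ring
    _ = _ := by
      rw [← Real.exp_add]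
      congr 4
      ring

/-- The modulus of the characteristic function of the tilted law stays away from `1` off the
origin, uniformly for small tilts. -/
theorem exists_norm_complexMGF_le_mul [IsProbabilityMeasure P] (hX : AEMeasurable X P) (hb : 0 < b)
    (hexp : Integrable (fun ω => Real.exp (b * |X ω|)) P) {N : ℕ}
    (hN : Filter.Tendsto (fun t => charFun (P.map X) t ^ N) (Filter.cocompact ℝ) (𝓝 0)) {δ : ℝ}
    (hδ : 0 < δ) :
    ∃ ρ r : ℝ, 0 ≤ ρ ∧ ρ < 1 ∧ 0 < r ∧ ∀ h t : ℝ, |h| ≤ r → δ ≤ |t| →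
      ‖complexMGF X P (h + t * Complex.I)‖ ≤ ρ * ‖complexMGF X P h‖ := by
  have hprob := Measure.isProbabilityMeasure_map (μ := P) hX
  obtain ⟨ρ, hρ0, hρ1, hρ⟩ := exists_norm_charFun_le hN hδ
  set C := 2 / b * ∫ ω, Real.exp (b * |X ω|) ∂P
  have hC : 0 ≤ C := mul_nonneg (by positivity) (integral_nonneg fun ω => (Real.exp_pos _).le)
  refine ⟨(1 + ρ) / 2, min (b / 2) ((1 - ρ) / (8 * (C + 1))), by linarith, by linarith,
    lt_min (by linarith) (div_pos (by linarith) (by linarith)), fun h t hh ht => ?_⟩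
  have hh1 : |h| ≤ b / 2 := hh.trans (min_le_left _ _)
  have hh2 : |h| * C ≤ (1 - ρ) / 8 := by
    have h5 : |h| * (8 * (C + 1)) ≤ 1 - ρ :=
      (le_div_iff₀ (by linarith)).1 (hh.trans (min_le_right _ _))
    nlinarith [abs_nonneg h]
  have h1 : ‖complexMGF X P (h + t * Complex.I)‖ ≤ ρ + (1 - ρ) / 8 := by
    have h6 := norm_complexMGF_sub_le hX hb hexp hh1 t
    rw [complexMGF_mul_I hX] at h6
    have h7 := norm_le_norm_add_norm_sub (charFun (P.map X) t)
      (complexMGF X P (h + t * Complex.I))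
    have h8 := hρ t ht
    rw [norm_sub_rev] at h7
    linarith
  have h2 : 1 - (1 - ρ) / 8 ≤ ‖complexMGF X P h‖ := by
    have h6 := norm_complexMGF_sub_le hX hb hexp hh1 0
    simp only [Complex.ofReal_zero, zero_mul, add_zero] at h6
    have h9 : complexMGF X P 0 = 1 := by simp [complexMGF]
    rw [h9] at h6
    have h7 := norm_le_norm_add_norm_sub (complexMGF X P h) 1
    rw [norm_one] at h7
    linarith
  nlinarith
end Tilt

/-! ### Taylor expansions of analytic functions -/

section Taylor

theorem AnalyticAt.iteratedDeriv_apply {𝕜 : Type*} [NontriviallyNormedField 𝕜] [CompleteSpace 𝕜]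
    {F : 𝕜 → 𝕜} {x : 𝕜} (hF : AnalyticAt 𝕜 F x) (k : ℕ) : AnalyticAt 𝕜 (iteratedDeriv k F) x := by
  induction k with
  | zero => simpa using hF
  | succ k ih => rw [iteratedDeriv_succ]; exact ih.deriv

/-- A complex analytic function that extends a real function has the same derivatives. -/
theorem eventually_iteratedDeriv_ofReal {F : ℂ → ℂ} {f : ℝ → ℝ} (hF : AnalyticAt ℂ F 0)
    (hFf : ∀ t : ℝ, F t = f t) (k : ℕ) :
    ∀ᶠ t : ℝ in 𝓝 0, iteratedDeriv k F t = iteratedDeriv k f t := by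
  have hc : Filter.Tendsto (fun t : ℝ => (t : ℂ)) (𝓝 0) (𝓝 0) := by
    simpa using Complex.continuous_ofReal.tendsto 0
  induction k with
  | zero => simpa using Filter.Eventually.of_forall hFf
  | succ k ih =>
    filter_upwards [ih.eventually_nhds,
      hc.eventually (hF.iteratedDeriv_apply k).eventually_analyticAt] with t ht hat
    have h1 := hat.differentiableAt.hasDerivAt
    have h2 : HasDerivAt (fun s : ℝ => ((iteratedDeriv k f s : ℝ) : ℂ))
        (deriv (iteratedDeriv k F) t) t :=
      h1.comp_ofReal.congr_of_eventuallyEq (ht.mono fun s hs => hs.symm)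
    have h3 : HasDerivAt (iteratedDeriv k f) (deriv (iteratedDeriv k F) t).re t :=
      h1.real_of_complex.congr_of_eventuallyEq (ht.mono fun s hs => by simp [hs])
    rw [iteratedDeriv_succ, iteratedDeriv_succ, h3.deriv]
    exact h2.unique h3.ofReal_comp

theorem AnalyticAt.isBigO_sub_taylor {F : ℂ → ℂ} (hF : AnalyticAt ℂ F 0) (n : ℕ) :
    (fun z => F z - ∑ k ∈ Finset.range n, iteratedDeriv k F 0 / (k.factorial : ℂ) * z ^ k)
      =O[𝓝 0] fun z => z ^ n := by
  have h := hF.hasFPowerSeriesAt.isBigO_sub_partialSum_pow n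
  simp only [zero_add, FormalMultilinearSeries.partialSum,
    FormalMultilinearSeries.ofScalars_apply_eq, smul_eq_mul] at h
  refine (h.congr_right fun z => (norm_pow z n).symm).of_norm_right

/-- If the derivatives of `F` at `0` of the orders strictly between `j` and `l` vanish, as well as
those below `j`, then `F` is a sum of two monomials up to higher order. -/
theorem AnalyticAt.isBigO_sub_two_terms {F : ℂ → ℂ} (hF : AnalyticAt ℂ F 0) {j l : ℕ} (hjl : j < l)
    (h0 : ∀ k, k < l → k ≠ j → iteratedDeriv k F 0 = 0) :
    (fun z => F z - iteratedDeriv j F 0 / (j.factorial : ℂ) * z ^ j -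
        iteratedDeriv l F 0 / (l.factorial : ℂ) * z ^ l) =O[𝓝 0] fun z => z ^ (l + 1) := by
  refine (hF.isBigO_sub_taylor (l + 1)).congr_left fun z => ?_
  rw [Finset.sum_range_succ, Finset.sum_eq_single j, sub_sub]
  · intro k hk hkj
    rw [h0 k (Finset.mem_range.1 hk) hkj]
    simp
  · intro h
    exact absurd (Finset.mem_range.2 hjl) h

theorem norm_le_mul_norm_pow_succ {ψ ψ' : ℂ → ℂ} {R A : ℝ} {k : ℕ} (hA : 0 ≤ A)
    (hd : ∀ w ∈ Metric.ball (0 : ℂ) R, HasDerivAt ψ (ψ' w) w)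
    (hb : ∀ w ∈ Metric.ball (0 : ℂ) R, ‖ψ' w‖ ≤ A * ‖w‖ ^ k) (h0 : ψ 0 = 0) :
    ∀ w ∈ Metric.ball (0 : ℂ) R, ‖ψ w‖ ≤ A * ‖w‖ ^ (k + 1) := by
  intro w hw
  have hsub : Metric.closedBall (0 : ℂ) ‖w‖ ⊆ Metric.ball 0 R :=
    Metric.closedBall_subset_ball (by simpa using hw)
  have h := (convex_closedBall (0 : ℂ) ‖w‖).norm_image_sub_le_of_norm_hasDerivWithin_le
    (f := ψ) (f' := ψ') (C := A * ‖w‖ ^ k) (x := 0) (y := w)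
    (fun v hv => (hd v (hsub hv)).hasDerivWithinAt)
    (fun v hv => (hb v (hsub hv)).trans (by
      have : ‖v‖ ≤ ‖w‖ := by simpa using hv
      gcongr)) (by simp) (by simp)
  simpa [h0, pow_succ, mul_assoc] using h

/-- Third-order Taylor expansion, uniform in the base point. -/
theorem norm_sub_taylor_le {F : ℂ → ℂ} {R A : ℝ} (hF : AnalyticOnNhd ℂ F (Metric.ball 0 (2 * R)))
    (hA : ∀ z ∈ Metric.ball (0 : ℂ) (2 * R), ‖iteratedDeriv 4 F z‖ ≤ A) {h w : ℂ}
    (hh : ‖h‖ < R) (hw : ‖w‖ < R) :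
    ‖F (h + w) - F h - deriv F h * w - iteratedDeriv 2 F h / 2 * w ^ 2 -
      iteratedDeriv 3 F h / 6 * w ^ 3‖ ≤ A * ‖w‖ ^ 4 := by
  have hmem : ∀ v ∈ Metric.ball (0 : ℂ) R, h + v ∈ Metric.ball (0 : ℂ) (2 * R) := by
    intro v hv
    rw [mem_ball_zero_iff] at hv ⊢
    linarith [norm_add_le h v]
  have hR : 0 < R := (norm_nonneg _).trans_lt hh
  have hA0 : 0 ≤ A := (norm_nonneg _).trans (hA 0 (by simpa using hR))
  have hd : ∀ k, ∀ v ∈ Metric.ball (0 : ℂ) R,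
      HasDerivAt (fun v => iteratedDeriv k F (h + v)) (iteratedDeriv (k + 1) F (h + v)) v := by
    intro k v hv
    have h1 := ((hF _ (hmem v hv)).iteratedDeriv_apply k).differentiableAt.hasDerivAt
    rw [← iteratedDeriv_succ] at h1
    exact h1.comp_const_add h v
  have hid : ∀ v : ℂ, HasDerivAt (fun v : ℂ => v) 1 v := fun v => hasDerivAt_id v
  have s3 := norm_le_mul_norm_pow_succ (k := 0) hA0
    (ψ := fun v => iteratedDeriv 3 F (h + v) - iteratedDeriv 3 F h)
    (fun v hv => (hd 3 v hv).sub_const _) (fun v hv => by simpa using hA _ (hmem v hv)) (by simp)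
  have s2 := norm_le_mul_norm_pow_succ hA0
    (ψ := fun v => iteratedDeriv 2 F (h + v) - iteratedDeriv 2 F h - iteratedDeriv 3 F h * v)
    (fun v hv => by
      have := ((hd 2 v hv).sub_const (iteratedDeriv 2 F h)).sub
        ((hid v).const_mul (iteratedDeriv 3 F h))
      exact this.congr_deriv (by simp)) s3 (by simp)
  have s1 := norm_le_mul_norm_pow_succ hA0
    (ψ := fun v => iteratedDeriv 1 F (h + v) - iteratedDeriv 1 F h - iteratedDeriv 2 F h * v -
      iteratedDeriv 3 F h / 2 * v ^ 2)
    (fun v hv => by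
      have := (((hd 1 v hv).sub_const (iteratedDeriv 1 F h)).sub
        ((hid v).const_mul (iteratedDeriv 2 F h))).sub
        (((hid v).pow 2).const_mul (iteratedDeriv 3 F h / 2))
      refine this.congr_deriv ?_
      simp
      ring) s2 (by simp)
  have s0 := norm_le_mul_norm_pow_succ hA0
    (ψ := fun v => F (h + v) - F h - iteratedDeriv 1 F h * v - iteratedDeriv 2 F h / 2 * v ^ 2 -
      iteratedDeriv 3 F h / 6 * v ^ 3)
    (fun v hv => by
      have h0 := hd 0 v hv
      simp only [iteratedDeriv_zero, zero_add] at h0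
      have := (((h0.sub_const (F h)).sub
        ((hid v).const_mul (iteratedDeriv 1 F h))).sub
        (((hid v).pow 2).const_mul (iteratedDeriv 2 F h / 2))).sub
        (((hid v).pow 3).const_mul (iteratedDeriv 3 F h / 6))
      refine this.congr_deriv ?_
      simp
      ring) s1 (by simp)
  have := s0 w (by simpa using hw)
  simpa using this

end Taylor

/-! ### The saddle point -/

section Saddle

theorem isBigO_pow_of_le {k l : ℕ} (h : l ≤ k) :
    (fun τ : ℂ => τ ^ k) =O[𝓝 0] fun τ => τ ^ l := by
  rcases h.eq_or_lt with rfl | h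
  · exact Asymptotics.isBigO_refl _ _
  · exact (Asymptotics.isLittleO_pow_pow h).isBigO

theorem AnalyticAt.natCast_le_analyticOrderAt_of_isBigO {f : ℂ → ℂ} (hf : AnalyticAt ℂ f 0) {n : ℕ}
    (hO : f =O[𝓝 0] fun τ => τ ^ n) : (n : ℕ∞) ≤ analyticOrderAt f 0 := by
  by_contra! hlt
  obtain ⟨k, hk⟩ := ENat.ne_top_iff_exists.1 hlt.ne_top
  rw [← hk, Nat.cast_lt] at hlt
  obtain ⟨g, hg, hg0, hfg⟩ := hf.analyticOrderAt_eq_natCast.1 hk.symm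
  simp only [sub_zero, smul_eq_mul] at hfg
  have h1 : (fun _ : ℂ => (1 : ℂ)) =O[𝓝 0] g := by
    have := (hg.continuousAt.inv₀ hg0).isBigO_one ℂ
    refine (this.mul (Asymptotics.isBigO_refl g _)).congr' ?_ (by simp)
    filter_upwards [hg.continuousAt.eventually_ne hg0] with τ hτ
    simp [hτ]
  have h2 : (fun τ : ℂ => τ ^ k) =O[𝓝 0] f := by
    refine ((Asymptotics.isBigO_refl (fun τ : ℂ => τ ^ k) (𝓝 0)).mul h1).congr' (by simp) ?_
    exact hfg.mono fun τ hτ => hτ.symm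
  have h3 := (h2.trans hO).trans_isLittleO (Asymptotics.isLittleO_pow_pow (𝕜 := ℂ) hlt)
  refine Asymptotics.isLittleO_irrefl ?_ h3
  have h4 : ∃ᶠ τ : ℂ in 𝓝[≠] 0, τ ^ k ≠ 0 :=
    Filter.Eventually.frequently <| eventually_mem_nhdsWithin.mono fun τ hτ => pow_ne_zero k hτ
  exact h4.filter_mono nhdsWithin_le_nhds

/-- The local inverse `z₀` of `K'`; it is real on the real axis because it extends the real local
inverse of the derivative of `κ = K|ℝ`. -/
theorem exists_saddlePoint {K : ℂ → ℂ} {κ : ℝ → ℝ} (hK : AnalyticAt ℂ K 0)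
    (hκ : AnalyticAt ℝ κ 0) (hKκ : ∀ t : ℝ, K t = κ t) (h1 : deriv κ 0 = 0)
    (h2 : iteratedDeriv 2 κ 0 = 1) :
    ∃ z₀ : ℂ → ℂ, AnalyticAt ℂ z₀ 0 ∧ z₀ 0 = 0 ∧ (∀ᶠ τ in 𝓝 0, deriv K (z₀ τ) = τ) ∧
      ∀ᶠ t : ℝ in 𝓝 0, (z₀ t).im = 0 := by
  have hc : Filter.Tendsto (fun t : ℝ => (t : ℂ)) (𝓝 0) (𝓝 0) := by
    simpa using Complex.continuous_ofReal.tendsto 0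
  have hK1 : deriv K 0 = 0 := by
    have := (eventually_iteratedDeriv_ofReal hK hKκ 1).self_of_nhds
    simpa [h1] using this
  have hK2 : deriv (deriv K) 0 = 1 := by
    have := (eventually_iteratedDeriv_ofReal hK hKκ 2).self_of_nhds
    simpa [h2, iteratedDeriv_succ] using this
  have hκ2 : deriv (deriv κ) 0 = 1 := by simpa [iteratedDeriv_succ] using h2
  have hne : deriv (deriv K) 0 ≠ 0 := by rw [hK2]; exact one_ne_zero
  have hne' : deriv (deriv κ) 0 ≠ 0 := by rw [hκ2]; exact one_ne_zero
  set z₀ := hK.deriv.hasStrictDerivAt.localInverse _ _ _ hne with hz₀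
  set y₀ := hκ.deriv.hasStrictDerivAt.localInverse _ _ _ hne' with hy₀
  have hza : AnalyticAt ℂ z₀ (deriv K 0) := hK.deriv.analyticAt_localInverse hne
  have hzz : z₀ (deriv K 0) = 0 := HasStrictFDerivAt.localInverse_apply_image ..
  have hya : AnalyticAt ℝ y₀ (deriv κ 0) := hκ.deriv.analyticAt_localInverse hne'
  have hyy : y₀ (deriv κ 0) = 0 := HasStrictFDerivAt.localInverse_apply_image ..
  have hzr : ∀ᶠ τ in 𝓝 (deriv K 0), deriv K (z₀ τ) = τ :=
    HasStrictFDerivAt.eventually_right_inverse ..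
  have hyr : ∀ᶠ t in 𝓝 (deriv κ 0), deriv κ (y₀ t) = t :=
    HasStrictFDerivAt.eventually_right_inverse ..
  have hzl : ∀ᶠ z in 𝓝 0, z₀ (deriv K z) = z :=
    HasStrictFDerivAt.eventually_left_inverse ..
  rw [hK1] at hza hzz hzr
  rw [h1] at hya hyy hyr
  refine ⟨z₀, hza, hzz, hzr, ?_⟩
  have hyt : Filter.Tendsto y₀ (𝓝 0) (𝓝 0) := by
    simpa [hyy] using hya.continuousAt.tendsto
  filter_upwards [hyr, hyt.eventually (hc.eventually hzl),
    hyt.eventually (eventually_iteratedDeriv_ofReal hK hKκ 1)] with t ht1 ht2 ht3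
  rw [iteratedDeriv_one, iteratedDeriv_one, ht1] at ht3
  rw [← ht3, ht2, Complex.ofReal_im]

variable {K z₀ : ℂ → ℂ}

theorem isBigO_pow_sub_pow (hO : (fun τ => z₀ τ - τ) =O[𝓝 0] fun τ => τ ^ 2) (j : ℕ) :
    (fun τ => z₀ τ ^ j - τ ^ j) =O[𝓝 0] fun τ => τ ^ (j + 1) := by
  have hz : z₀ =O[𝓝 0] fun τ => τ := by
    have h1 := (hO.trans (isBigO_pow_of_le one_le_two)).add
      (Asymptotics.isBigO_refl (fun τ : ℂ => τ ^ 1) _)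
    simpa using h1
  induction j with
  | zero => simpa using Asymptotics.isBigO_zero _ _
  | succ j ih =>
    have h1 := (hz.mul ih).add ((Asymptotics.isBigO_refl (fun τ : ℂ => τ ^ j) (𝓝 0)).mul hO
      |>.congr_right (g₂ := fun τ => τ * τ ^ (j + 1)) fun τ => by ring)
    exact (h1.congr_left fun τ => by ring).congr_right fun τ => by ring

/-- Expansions at the saddle point. Here `m` need not be the first non-zero cumulant: only the
cumulants of the orders `3, …, m - 1` have to vanish. -/
theorem saddlePoint_expansions (hK : AnalyticAt ℂ K 0) (hK0 : K 0 = 0) (hK1 : deriv K 0 = 0)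
    (hK2 : iteratedDeriv 2 K 0 = 1) (hz : AnalyticAt ℂ z₀ 0) (hz0 : z₀ 0 = 0)
    (hsad : ∀ᶠ τ in 𝓝 0, deriv K (z₀ τ) = τ) {m : ℕ} (hm : 3 ≤ m)
    (hγ : ∀ k, 3 ≤ k → k < m → iteratedDeriv k K 0 = 0) :
    (fun τ => K (z₀ τ) - τ * z₀ τ + τ ^ 2 / 2 -
        iteratedDeriv m K 0 / (m.factorial : ℂ) * τ ^ m) =O[𝓝 0] (fun τ => τ ^ (m + 1)) ∧
    (fun τ => Complex.log (iteratedDeriv 2 K (z₀ τ)) / 2 -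
        iteratedDeriv m K 0 / (2 * ((m - 2).factorial : ℂ)) * τ ^ (m - 2))
      =O[𝓝 0] (fun τ => τ ^ (m - 1)) := by
  obtain ⟨n, rfl⟩ := Nat.exists_eq_add_of_le' hm
  have hzt : Filter.Tendsto z₀ (𝓝 0) (𝓝 0) := by simpa [hz0] using hz.continuousAt.tendsto
  have hzO : z₀ =O[𝓝 0] fun τ => τ := by
    simpa [hz0] using hz.differentiableAt.isBigO_sub
  have hv : ∀ k, k < n + 3 → k ≠ 2 → iteratedDeriv k K 0 = 0 := by
    intro k hk hk2
    rcases lt_or_ge k 3 with h | h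
    · interval_cases k
      · simpa using hK0
      · simpa using hK1
      · exact absurd rfl hk2
    · exact hγ k h hk
  set γ := iteratedDeriv (n + 3) K 0 with hγdef
  have d1 : ∀ k, iteratedDeriv k (deriv K) = iteratedDeriv (k + 1) K := fun k =>
    iteratedDeriv_succ'.symm
  have d2 : ∀ k, iteratedDeriv k (iteratedDeriv 2 K) = iteratedDeriv (k + 2) K := fun k => by
    rw [iteratedDeriv_succ' (n := k + 1), iteratedDeriv_succ' (n := k), iteratedDeriv_succ,
      iteratedDeriv_one]
  have T0 := hK.isBigO_sub_two_terms (j := 2) (l := n + 3) (by omega) hv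
  have T1 := hK.deriv.isBigO_sub_two_terms (j := 1) (l := n + 2) (by omega)
    (fun k hk hk1 => by rw [d1]; exact hv _ (by omega) (by omega))
  have T2 := (hK.iteratedDeriv_apply 2).isBigO_sub_two_terms (j := 0) (l := n + 1) (by omega)
    (fun k hk hk1 => by rw [d2]; exact hv _ (by omega) (by omega))
  simp only [d1, d2, hK2, ← hγdef, zero_add, Nat.reduceAdd, Nat.factorial_one, Nat.factorial_zero,
    Nat.cast_one, div_one, one_mul, pow_one, pow_zero, Nat.factorial_two, Nat.cast_ofNat] at T0 T1 T2
  replace T0 := (T0.comp_tendsto hzt).trans (hzO.pow (n + 3 + 1))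
  replace T1 := (T1.comp_tendsto hzt).trans (hzO.pow (n + 2 + 1))
  replace T2 := (T2.comp_tendsto hzt).trans (hzO.pow (n + 1 + 1))
  simp only [Function.comp_def] at T0 T1 T2
  -- `z₀ τ = τ + O(τ ^ (m - 1))`
  have hz1 : (fun τ => z₀ τ - τ) =O[𝓝 0] fun τ => τ ^ (n + 2) := by
    have a1 : (fun τ => γ / ((n + 2).factorial : ℂ) * z₀ τ ^ (n + 2)) =O[𝓝 0]
        fun τ => τ ^ (n + 2) := (hzO.pow _).const_mul_left _
    have a2 := ((T1.trans (isBigO_pow_of_le (Nat.le_succ (n + 2)))).add a1).neg_left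
    refine a2.congr' (hsad.mono fun τ hτ => ?_) Filter.EventuallyEq.rfl
    simp only [hτ]
    ring
  have hz2 := isBigO_pow_sub_pow (hz1.trans (isBigO_pow_of_le (by omega)))
  constructor
  · have a1 : (fun τ => (z₀ τ - τ) ^ 2 / 2) =O[𝓝 0] fun τ => τ ^ (n + 3 + 1) := by
      have := (hz1.pow 2).const_mul_left (1 / 2)
      refine (this.congr_left fun τ => by ring).trans ?_
      simp only [← pow_mul]
      exact isBigO_pow_of_le (by omega)
    have a2 := (hz2 (n + 3)).const_mul_left (γ / ((n + 3).factorial : ℂ))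
    refine ((T0.add a1).add a2).congr_left fun τ => ?_
    ring
  · have e1 : n + 3 - 2 = n + 1 := by omega
    have e2 : n + 3 - 1 = n + 2 := by omega
    rw [e1, e2]
    have a2 := (hz2 (n + 1)).const_mul_left (γ / ((n + 1).factorial : ℂ))
    have hw : (fun τ => iteratedDeriv 2 K (z₀ τ) - 1 -
        γ / ((n + 1).factorial : ℂ) * τ ^ (n + 1)) =O[𝓝 0] fun τ => τ ^ (n + 2) := by
      refine (T2.add a2).congr_left fun τ => ?_
      ring
    have hw1 : (fun τ => iteratedDeriv 2 K (z₀ τ) - 1) =O[𝓝 0] fun τ => τ ^ (n + 1) := by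
      have a3 : (fun τ => γ / ((n + 1).factorial : ℂ) * τ ^ (n + 1)) =O[𝓝 0]
        fun τ => τ ^ (n + 1) := (Asymptotics.isBigO_refl _ _).const_mul_left _
      refine ((hw.trans (isBigO_pow_of_le (Nat.le_succ (n + 1)))).add a3).congr_left fun τ => ?_
      ring
    have hwt : Filter.Tendsto (fun τ => iteratedDeriv 2 K (z₀ τ) - 1) (𝓝 0) (𝓝 0) := by
      refine hw1.trans_tendsto ?_
      have : Continuous fun τ : ℂ => τ ^ (n + 1) := by fun_prop
      simpa using this.tendsto 0
    have hlog : (fun w : ℂ => Complex.log (1 + w) - w) =O[𝓝 0] fun w => w ^ 2 := by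
      refine Asymptotics.IsBigO.of_bound 1 ?_
      filter_upwards [Metric.ball_mem_nhds (0 : ℂ) (show (0 : ℝ) < 1 / 2 by norm_num)] with w hw
      rw [mem_ball_zero_iff] at hw
      refine (Complex.norm_log_one_add_sub_self_le (by linarith)).trans ?_
      rw [norm_pow, one_mul, mul_div_assoc]
      refine mul_le_of_le_one_right (by positivity) ?_
      rw [div_le_one (by norm_num)]
      exact inv_le_of_inv_le₀ (by norm_num) (by linarith)
    have hl := (hlog.comp_tendsto hwt).trans (hw1.pow 2)
    simp only [Function.comp_def, ← pow_mul] at hl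
    have hl2 := ((hl.trans (isBigO_pow_of_le (by omega : n + 2 ≤ (n + 1) * 2))).add
      hw).const_mul_left (1 / 2)
    refine hl2.congr_left fun τ => ?_
    rw [add_sub_cancel]
    field_simp
    ring

/-- The Cramér series `λ` exists, because `K(z₀(τ)) - τ z₀(τ) + τ² / 2` vanishes to third order. -/
theorem exists_cramerSeries (hK : AnalyticAt ℂ K 0) (hK0 : K 0 = 0) (hK1 : deriv K 0 = 0)
    (hK2 : iteratedDeriv 2 K 0 = 1) (hz : AnalyticAt ℂ z₀ 0) (hz0 : z₀ 0 = 0)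
    (hsad : ∀ᶠ τ in 𝓝 0, deriv K (z₀ τ) = τ) :
    ∃ lam : ℂ → ℂ, AnalyticAt ℂ lam 0 ∧
      ∀ᶠ τ in 𝓝 0, τ ^ 3 * lam τ = K (z₀ τ) - τ * z₀ τ + τ ^ 2 / 2 := by
  have hg : AnalyticAt ℂ (fun τ => K (z₀ τ) - τ * z₀ τ + τ ^ 2 / 2) 0 := by
    have : AnalyticAt ℂ (fun τ => K (z₀ τ)) 0 :=
      AnalyticAt.comp (g := K) (f := z₀) (by rwa [hz0]) hz
    exact (this.sub (analyticAt_id.mul hz)).add ((analyticAt_id.pow 2).div analyticAt_const two_ne_zero)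
  have hO : (fun τ => K (z₀ τ) - τ * z₀ τ + τ ^ 2 / 2) =O[𝓝 0] fun τ : ℂ => τ ^ 3 := by
    have h3 := (saddlePoint_expansions hK hK0 hK1 hK2 hz hz0 hsad le_rfl
      (fun k h h' => absurd h' (not_lt.2 h))).1
    have h4 : (fun τ => iteratedDeriv 3 K 0 / ((3).factorial : ℂ) * τ ^ 3) =O[𝓝 0]
        fun τ : ℂ => τ ^ 3 := (Asymptotics.isBigO_refl _ _).const_mul_left _
    refine ((h3.trans (isBigO_pow_of_le (Nat.le_succ 3))).add h4).congr_left fun τ => ?_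
    ring
  have hord : ((3 : ℕ) : ℕ∞) ≤ analyticOrderAt (fun τ => K (z₀ τ) - τ * z₀ τ + τ ^ 2 / 2) 0 :=
    hg.natCast_le_analyticOrderAt_of_isBigO hO
  obtain ⟨lam, hlam, h⟩ := (natCast_le_analyticOrderAt hg).1 hord
  refine ⟨lam, hlam, h.mono fun τ hτ => ?_⟩
  simpa using hτ.symm

end Saddle

/-! ### The log-Laplace transform and the cumulants -/

section LogLaplace

variable {Ω : Type*} [MeasurableSpace Ω] {P : Measure Ω} {X : Ω → ℝ} {b : ℝ}

theorem mem_interior_integrableExpSet (hX : AEMeasurable X P)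
    (hexp : Integrable (fun ω => Real.exp (b * |X ω|)) P) {h : ℝ} (hh : |h| < b) :
    h ∈ interior (integrableExpSet X P) := by
  rw [mem_interior]
  refine ⟨Set.Ioo (-b) b, fun t ht => ?_, isOpen_Ioo, abs_lt.1 hh⟩
  exact integrable_exp_mul_of_abs_le hX hexp (abs_lt.2 ht).le

theorem analyticAt_complexMGF_of_abs_lt (hX : AEMeasurable X P)
    (hexp : Integrable (fun ω => Real.exp (b * |X ω|)) P) {z : ℂ} (hz : |z.re| < b) :
    AnalyticAt ℂ (complexMGF X P) z :=
  analyticAt_complexMGF (mem_interior_integrableExpSet hX hexp hz)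

theorem complexMGF_zero [IsProbabilityMeasure P] : complexMGF X P 0 = 1 := by simp [complexMGF]

theorem analyticAt_logLaplace_zero [IsProbabilityMeasure P] (hX : AEMeasurable X P)
    (hb : 0 < b)
    (hexp : Integrable (fun ω => Real.exp (b * |X ω|)) P) : AnalyticAt ℂ (logLaplace X P) 0 := by
  refine (analyticAt_complexMGF_of_abs_lt hX hexp (by simpa using hb)).clog ?_
  rw [complexMGF_zero]
  exact Complex.one_mem_slitPlane

theorem logLaplace_ofReal (t : ℝ) : logLaplace X P t = cgf X P t := by
  rw [logLaplace, complexMGF_ofReal, cgf, Complex.ofReal_log mgf_nonneg]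

theorem iteratedDeriv_logLaplace_zero [IsProbabilityMeasure P] (hX : AEMeasurable X P)
    (hb : 0 < b)
    (hexp : Integrable (fun ω => Real.exp (b * |X ω|)) P) (k : ℕ) :
    iteratedDeriv k (logLaplace X P) 0 = cumulant X P k := by
  have := (eventually_iteratedDeriv_ofReal (analyticAt_logLaplace_zero hX hb hexp)
    logLaplace_ofReal k).self_of_nhds
  rwa [Complex.ofReal_zero] at this

theorem cumulant_one (hX : AEMeasurable X P) (hb : 0 < b)
    (hexp : Integrable (fun ω => Real.exp (b * |X ω|)) P) (hmean : ∫ ω, X ω ∂P = 0) :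
    cumulant X P 1 = 0 := by
  rw [cumulant, iteratedDeriv_one,
    deriv_cgf_zero (mem_interior_integrableExpSet hX hexp (by simpa using hb)), hmean, zero_div]

theorem cumulant_two [IsProbabilityMeasure P] (hX : AEMeasurable X P)
    (hb : 0 < b)
    (hexp : Integrable (fun ω => Real.exp (b * |X ω|)) P) (hmean : ∫ ω, X ω ∂P = 0) :
    cumulant X P 2 = variance X P := by
  have h1 := cumulant_one hX hb hexp hmean
  rw [cumulant, iteratedDeriv_one] at h1
  rw [cumulant, iteratedDeriv_two_cgf_eq_integral
    (mem_interior_integrableExpSet hX hexp (by simpa using hb)), h1,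
    variance_of_integral_eq_zero hX hmean]
  simp

theorem cumulant_zero [IsProbabilityMeasure P] : cumulant X P 0 = 0 := by simp [cumulant]

theorem exp_logLaplace {z : ℂ} (hz : complexMGF X P z ≠ 0) :
    Complex.exp (logLaplace X P z) = complexMGF X P z := Complex.exp_log hz

/-- A law all of whose cumulants of order at least `3` vanish is normal: its moment generating
function is `e^{z²/2}` near `0`, hence on the whole strip by analytic continuation. -/
theorem map_eq_gaussianReal_of_cumulant_eq_zero [IsProbabilityMeasure P] (hX : AEMeasurable X P)
    (hb : 0 < b)
    (hexp : Integrable (fun ω => Real.exp (b * |X ω|)) P) (hmean : ∫ ω, X ω ∂P = 0)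
    (hvar : variance X P = 1) (h : ∀ k, 3 ≤ k → cumulant X P k = 0) :
    P.map X = gaussianReal 0 1 := by
  have hK := analyticAt_logLaplace_zero hX hb hexp
  have hder := iteratedDeriv_logLaplace_zero hX hb hexp
  have h2 : cumulant X P 2 = 1 := by rw [cumulant_two hX hb hexp hmean, hvar]
  have hv : ∀ k, k ≠ 2 → iteratedDeriv k (logLaplace X P) 0 = 0 := by
    intro k hk
    rw [hder]
    rcases lt_or_ge k 3 with h3 | h3
    · interval_cases k
      · simp [cumulant_zero]
      · simp [cumulant_one hX hb hexp hmean]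
      · exact absurd rfl hk
    · simp [h k h3]
  have hD : AnalyticAt ℂ (fun z => logLaplace X P z - z ^ 2 / 2) 0 :=
    hK.sub ((analyticAt_id.pow 2).div analyticAt_const two_ne_zero)
  have hord : analyticOrderAt (fun z => logLaplace X P z - z ^ 2 / 2) 0 = ⊤ := by
    refine ENat.eq_top_iff_forall_ge.2 fun n => ?_
    have h3 := hK.isBigO_sub_two_terms (j := 2) (l := n + 3) (by omega) (fun k _ hk => hv k hk)
    rw [hv (n + 3) (by omega), hder, h2] at h3
    refine hD.natCast_le_analyticOrderAt_of_isBigO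
      ((h3.congr_left fun z => ?_).trans (isBigO_pow_of_le (by omega)))
    simp
    ring
  have hloc : ∀ᶠ z in 𝓝 0, complexMGF X P z = Complex.exp (z ^ 2 / 2) := by
    have hne : ∀ᶠ z in 𝓝 0, complexMGF X P z ≠ 0 :=
      (analyticAt_complexMGF_of_abs_lt hX hexp (by simpa using hb)).continuousAt.eventually_ne
        (by rw [complexMGF_zero]; exact one_ne_zero)
    filter_upwards [hne, analyticOrderAt_eq_top.1 hord] with z hz hz2
    rw [← exp_logLaplace hz, sub_eq_zero.1 hz2]
  have hpre : IsPreconnected {z : ℂ | |z.re| < b} := by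
    have : {z : ℂ | |z.re| < b} = Complex.reLm ⁻¹' Set.Ioo (-b) b := by
      ext z; simp [abs_lt]
    rw [this]
    exact ((convex_Ioo (-b) b).linear_preimage Complex.reLm).isPreconnected
  have heq := AnalyticOnNhd.eqOn_of_preconnected_of_eventuallyEq
    (f := complexMGF X P) (g := fun z => Complex.exp (z ^ 2 / 2)) (U := {z : ℂ | |z.re| < b})
    (fun z hz => analyticAt_complexMGF_of_abs_lt hX hexp hz)
    (fun z _ => AnalyticAt.cexp' ((analyticAt_id.pow 2).div analyticAt_const two_ne_zero)) hpre
    (z₀ := 0) (by simpa using hb) hloc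
  have := Measure.isProbabilityMeasure_map (μ := P) hX
  apply Measure.ext_of_charFun
  ext t
  have h4 := heq (x := t * Complex.I) (by simpa using hb)
  simp only [complexMGF_mul_I hX] at h4
  rw [h4, charFun_gaussianReal]
  congr 1
  rw [mul_pow, Complex.I_sq]
  simp
  ring

theorem exists_isFirstCumulantOrder [IsProbabilityMeasure P] (hX : AEMeasurable X P)
    (hb : 0 < b)
    (hexp : Integrable (fun ω => Real.exp (b * |X ω|)) P) (hmean : ∫ ω, X ω ∂P = 0)
    (hvar : variance X P = 1) (hne : P.map X ≠ gaussianReal 0 1) :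
    ∃ m, IsFirstCumulantOrder X P m := by
  classical
  have hex : ∃ k, 3 ≤ k ∧ cumulant X P k ≠ 0 := by
    by_contra! h
    exact hne (map_eq_gaussianReal_of_cumulant_eq_zero hX hb hexp hmean hvar h)
  refine ⟨Nat.find hex, (Nat.find_spec hex).1, (Nat.find_spec hex).2, fun k h3 hk => ?_⟩
  by_contra h
  exact Nat.find_min hex hk ⟨h3, h⟩

end LogLaplace

/-! ### The saddle point integral -/

section SaddleIntegral

/-- Laplace's method for the tilted inversion integral. The phase `e^{-itτ}` with `τ = K'(h)`
removes the linear term of `K(h + it)`, which is what the choice of the saddle point is for. -/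
theorem exists_saddle_integral_bound {Ω : Type*} [MeasurableSpace Ω] {P : Measure Ω}
    [IsProbabilityMeasure P] {X : Ω → ℝ} {b : ℝ} (hX : AEMeasurable X P) (hb : 0 < b)
    (hexp : Integrable (fun ω => Real.exp (b * |X ω|)) P) (hvar : cumulant X P 2 = 1) {N : ℕ}
    (hN : Filter.Tendsto (fun t => charFun (P.map X) t ^ N) (Filter.cocompact ℝ) (𝓝 0)) {J : ℝ}
    (hJ : ∀ h : ℝ, |h| ≤ b / 2 →
      Integrable (fun t : ℝ => ‖complexMGF X P (h + t * Complex.I)‖ ^ N) ∧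
        ∫ t : ℝ, ‖complexMGF X P (h + t * Complex.I)‖ ^ N ≤ J) :
    ∃ r C : ℝ, 0 < r ∧ r ≤ b / 2 ∧ 0 ≤ C ∧ ∀ h τ : ℝ, |h| ≤ r → deriv (logLaplace X P) h = τ →
      iteratedDeriv 2 (logLaplace X P) h = iteratedDeriv 2 (cgf X P) h ∧
      1 / 2 ≤ iteratedDeriv 2 (cgf X P) h ∧ iteratedDeriv 2 (cgf X P) h ≤ 3 / 2 ∧
      ∀ n : ℕ, N ≤ n → 1 ≤ n →
        ‖(∫ t : ℝ, (complexMGF X P (h + t * Complex.I) / complexMGF X P h *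
            Complex.exp (-(t * τ * Complex.I))) ^ n) -
          ((√(2 * Real.pi / (n * iteratedDeriv 2 (cgf X P) h)) : ℝ) : ℂ)‖ ≤
            C / (n * √(n : ℝ)) := by
  set L := complexMGF X P with hL
  set K := logLaplace X P with hKdef
  have hK : AnalyticAt ℂ K 0 := analyticAt_logLaplace_zero hX hb hexp
  have hLa : ∀ z : ℂ, |z.re| < b → AnalyticAt ℂ L z := fun z hz =>
    analyticAt_complexMGF_of_abs_lt hX hexp hz
  have hK2 : iteratedDeriv 2 K 0 = 1 := by
    rw [iteratedDeriv_logLaplace_zero hX hb hexp, hvar, Complex.ofReal_one]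
  set A : ℝ := ‖iteratedDeriv 4 K 0‖ + ‖iteratedDeriv 3 K 0‖ + 1 with hAdef
  have hA : 0 < A := by positivity
  -- a ball on which `K` is analytic and all relevant quantities are controlled
  have hev : ∀ᶠ z in 𝓝 (0 : ℂ), AnalyticAt ℂ K z ∧ ‖iteratedDeriv 4 K z‖ < A ∧
      ‖iteratedDeriv 3 K z‖ < A ∧ ‖iteratedDeriv 2 K z - 1‖ < 1 / 2 ∧ 1 / 2 < ‖L z‖ := by
    have c : ∀ k, ContinuousAt (iteratedDeriv k K) 0 := fun k =>
      (hK.iteratedDeriv_apply k).continuousAt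
    refine hK.eventually_analyticAt.and (((c 4).norm.eventually_lt_const ?_).and
      (((c 3).norm.eventually_lt_const ?_).and
      ((((c 2).sub continuousAt_const).norm.eventually_lt_const ?_).and
      ((hLa 0 (by simpa using hb)).continuousAt.norm.eventually_const_lt ?_))))
    · rw [hAdef]; linarith [norm_nonneg (iteratedDeriv 3 K 0)]
    · rw [hAdef]; linarith [norm_nonneg (iteratedDeriv 4 K 0)]
    · simp [hK2]
    · simp only [hL, complexMGF_zero]; norm_num
  obtain ⟨ε, hε, hball⟩ := Metric.eventually_nhds_iff_ball.1 hev
  obtain ⟨ε', hε', hreal⟩ := Metric.eventually_nhds_iff_ball.1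
    (eventually_iteratedDeriv_ofReal hK logLaplace_ofReal 2)
  set R := ε / 2 with hRdef
  have hR : 0 < R := by positivity
  have hR2 : 2 * R = ε := by rw [hRdef]; ring
  set δ := min (R / 2) (min 1 (1 / (32 * (A + 1)))) with hδdef
  have hδ : 0 < δ := by positivity
  have hδR : δ < R := (min_le_left _ _).trans_lt (by linarith)
  have hδ1 : δ ≤ 1 := (min_le_right _ _).trans (min_le_left _ _)
  have hAδ : A * δ * (1 + δ) ≤ 1 / 16 := by
    have h1 : δ ≤ 1 / (32 * (A + 1)) := (min_le_right _ _).trans (min_le_right _ _)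
    rw [le_div_iff₀ (by positivity)] at h1
    nlinarith [mul_pos hA hδ]
  obtain ⟨ρ, r₁, hρ0, hρ1, hr1, hρ⟩ := exists_norm_complexMGF_le_mul hX hb hexp hN hδ
  have hJ0 : 0 ≤ J := (integral_nonneg fun t => by positivity).trans
    (hJ 0 (by rw [abs_zero]; positivity)).2
  obtain ⟨C, hC, hmain⟩ := exists_laplace_bound (J := 2 ^ N * J) N hA.le hδ hAδ hρ0 hρ1
    (by positivity)
  refine ⟨min (min (R / 2) (ε' / 2)) (min r₁ (b / 2)), C, by positivity,
    (min_le_right _ _).trans (min_le_right _ _), hC, fun h τ hh hτ => ?_⟩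
  have hhR : |h| < R := lt_of_le_of_lt (hh.trans ((min_le_left _ _).trans (min_le_left _ _)))
    (by linarith)
  have hhε : |h| < ε' := lt_of_le_of_lt (hh.trans ((min_le_left _ _).trans (min_le_right _ _)))
    (by linarith)
  have hhr : |h| ≤ r₁ := hh.trans ((min_le_right _ _).trans (min_le_left _ _))
  have hhb : |h| ≤ b / 2 := hh.trans ((min_le_right _ _).trans (min_le_right _ _))
  obtain ⟨-, -, b3, b2, bL⟩ := hball h (by simpa using (by linarith : |h| < ε))
  have hs := hreal h (by simpa using hhε)
  set s := iteratedDeriv 2 (cgf X P) h with hsdef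
  have hs1 : |s - 1| < 1 / 2 := by
    rw [hs, ← Complex.ofReal_one, ← Complex.ofReal_sub, Complex.norm_real] at b2
    exact b2
  rw [abs_lt] at hs1
  refine ⟨hs, by linarith, by linarith, fun n hNn hn => ?_⟩
  have hLh : L h ≠ 0 := norm_pos_iff.1 (by linarith)
  have hnormF : ∀ t : ℝ, ‖L (h + t * Complex.I) / L h * Complex.exp (-(t * τ * Complex.I))‖ =
      ‖L (h + t * Complex.I)‖ / ‖L h‖ := by
    intro t
    have : -(t * τ * Complex.I) = ((-(t * τ) : ℝ) : ℂ) * Complex.I := by push_cast; ring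
    rw [norm_mul, norm_div, this, Complex.norm_exp_ofReal_mul_I, mul_one]
  have hbound : ∀ t : ℝ, ‖L (h + t * Complex.I) / L h * Complex.exp (-(t * τ * Complex.I))‖ ^ N ≤
      2 ^ N * ‖L (h + t * Complex.I)‖ ^ N := by
    intro t
    rw [hnormF, ← mul_pow]
    gcongr
    rw [div_le_iff₀ (by linarith)]
    nlinarith [norm_nonneg (L (h + t * Complex.I))]
  have hcont : Continuous fun t : ℝ =>
      L (h + t * Complex.I) / L h * Complex.exp (-(t * τ * Complex.I)) := by
    refine Continuous.mul (Continuous.div_const ?_ _) (by fun_prop)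
    rw [continuous_iff_continuousAt]
    intro t
    have h1 : ContinuousAt L (h + t * Complex.I) := (hLa _ (by simp; linarith)).continuousAt
    exact ContinuousAt.comp (g := L) h1 (by fun_prop)
  have hint : Integrable fun t : ℝ =>
      ‖L (h + t * Complex.I) / L h * Complex.exp (-(t * τ * Complex.I))‖ ^ N :=
    ((hJ h hhb).1.const_mul _).mono' (hcont.norm.pow N).aestronglyMeasurable
      (ae_of_all _ fun t => by rw [Real.norm_of_nonneg (by positivity)]; exact hbound t)
  refine hmain _ s (iteratedDeriv 3 K h / 6 * Complex.I ^ 3)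
    (fun t => K (h + t * Complex.I) - K h - deriv K h * (t * Complex.I) -
      iteratedDeriv 2 K h / 2 * (t * Complex.I) ^ 2 - iteratedDeriv 3 K h / 6 * (t * Complex.I) ^ 3)
    n hNn hn (by linarith) ?_ ?_ ?_ hcont hint ?_
  · rw [norm_mul, norm_pow, Complex.norm_I, one_pow, mul_one, norm_div]
    norm_num
    linarith [norm_nonneg (iteratedDeriv 3 K h)]
  · intro t ht
    have hw : ‖(t * Complex.I : ℂ)‖ = |t| := by simp
    constructor
    · have h1 := norm_sub_taylor_le (F := K) (R := R) (A := A) (h := h) (w := t * Complex.I)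
        (fun z hz => (hball z (by rwa [hR2] at hz)).1)
        (fun z hz => (hball z (by rwa [hR2] at hz)).2.1.le) (by simpa using hhR)
        (by rw [hw]; linarith)
      refine h1.trans_eq ?_
      rw [hw, show |t| ^ 4 = (|t| ^ 2) ^ 2 by ring, sq_abs]
      ring
    · have hmem : (h + t * Complex.I : ℂ) ∈ Metric.ball (0 : ℂ) ε := by
        rw [mem_ball_zero_iff]
        refine (norm_add_le _ _).trans_lt ?_
        rw [hw, Complex.norm_real, Real.norm_eq_abs]
        linarith
      have hLt : L (h + t * Complex.I) ≠ 0 :=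
        norm_pos_iff.1 (by linarith [(hball _ hmem).2.2.2.2])
      have hexpK : ∀ z, L z ≠ 0 → L z = Complex.exp (K z) := fun z hz => (exp_logLaplace hz).symm
      rw [hexpK _ hLt, hexpK _ hLh, ← Complex.exp_sub, ← Complex.exp_add, hτ, hs]
      congr 1
      push_cast
      rw [mul_pow (t : ℂ) Complex.I 2, Complex.I_sq]
      ring
  · intro t ht
    rw [hnormF, div_le_iff₀ (by linarith)]
    exact hρ h t hhr ht.le
  · calc _ ≤ ∫ t : ℝ, 2 ^ N * ‖L (h + t * Complex.I)‖ ^ N :=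
          integral_mono hint ((hJ h hhb).1.const_mul _) hbound
      _ ≤ _ := by
          rw [integral_const_mul]
          gcongr
          exact (hJ h hhb).2

end SaddleIntegral

section LocalExpansion

variable {Ω : Type*} [MeasurableSpace Ω] {P : Measure Ω} {X : ℕ → Ω → ℝ} {b : ℝ}

theorem integrable_exp_mul_map_sum [IsProbabilityMeasure P]
    (hindep : iIndepFun X P)
    (hident : ∀ i, IdentDistrib (X i) (X 0) P P)
    (hexp : Integrable (fun ω => Real.exp (b * |X 0 ω|)) P) {h : ℝ} (hh : |h| ≤ b) (n : ℕ) :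
    Integrable (fun x => Real.exp (h * x))
      (P.map (fun ω => ∑ i ∈ Finset.range n, X i ω)) ∧
    ∫ x, Real.exp (h * x) ∂(P.map (fun ω => ∑ i ∈ Finset.range n, X i ω)) =
      mgf (X 0) P h ^ n := by
  have h1 := complexMGF_sum_range hindep hident n h
  rw [complexMGF_ofReal, complexMGF_ofReal] at h1
  have h2 : mgf id (P.map (fun ω => ∑ i ∈ Finset.range n, X i ω)) h = mgf (X 0) P h ^ n := by
    exact_mod_cast h1
  refine ⟨Integrable.of_integral_ne_zero ?_, h2⟩
  have h3 : 0 < mgf (X 0) P h :=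
    mgf_pos (integrable_exp_mul_of_abs_le (hident 0).aemeasurable_fst hexp hh)
  have h4 : mgf id (P.map (fun ω => ∑ i ∈ Finset.range n, X i ω)) h ≠ 0 := by
    rw [h2]; positivity
  exact h4

/-- If the sum of `n₀` variables has a bounded density, then the powers of order `2 n₀` of the
moment generating function are integrable along vertical lines, with a uniform bound. -/
theorem integral_norm_complexMGF_pow_le [IsProbabilityMeasure P]
    (hindep : iIndepFun X P)
    (hident : ∀ i, IdentDistrib (X i) (X 0) P P)
    (hexp : Integrable (fun ω => Real.exp (b * |X 0 ω|)) P) {f : ℝ → ℝ} {M : ℝ} {n₀ : ℕ}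
    (hf : IsDensity (P.map (fun ω => ∑ i ∈ Finset.range n₀, X i ω)) f) (hM : ∀ x, f x ≤ M)
    {h : ℝ} (hh : |h| ≤ b / 2) :
    Integrable (fun t : ℝ => ‖complexMGF (X 0) P (h + t * Complex.I)‖ ^ (2 * n₀)) ∧
      ∫ t : ℝ, ‖complexMGF (X 0) P (h + t * Complex.I)‖ ^ (2 * n₀) ≤
        2 * Real.pi * (M * (∫ ω, Real.exp (b * |X 0 ω|) ∂P) ^ n₀) := by
  have hX : AEMeasurable (X 0) P := (hident 0).aemeasurable_fst
  have hM0 : 0 ≤ M := (hf.nonneg 0).trans (hM 0)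
  have hh2 : |2 * h| ≤ b := by rw [abs_mul, abs_two]; linarith
  have hp := Measure.isProbabilityMeasure_map (μ := P)
    (Finset.aemeasurable_fun_sum (Finset.range n₀) fun i _ => (hident i).aemeasurable_fst)
  obtain ⟨h1, -⟩ := integrable_exp_mul_map_sum hindep hident hexp
    (hh.trans (by linarith [abs_nonneg h])) n₀
  obtain ⟨h2, h3⟩ := integrable_exp_mul_map_sum hindep hident hexp hh2 n₀
  obtain ⟨h4, h5⟩ := hf.integral_norm_sq_complexMGF_le hM h1 h2
  simp only [complexMGF_sum_range hindep hident, norm_pow, ← pow_mul, mul_comm n₀ 2] at h4 h5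
  refine ⟨h4, h5.trans ?_⟩
  rw [h3]
  gcongr
  · exact mgf_nonneg
  · refine integral_mono (integrable_exp_mul_of_abs_le hX hexp hh2) hexp fun ω => ?_
    apply Real.exp_le_exp.2
    calc 2 * h * X 0 ω ≤ |2 * h * X 0 ω| := le_abs_self _
      _ = |2 * h| * |X 0 ω| := abs_mul _ _
      _ ≤ _ := by gcongr

theorem map_normalizedSum (hident : ∀ i, IdentDistrib (X i) (X 0) P P) (n : ℕ) :
    P.map (normalizedSum X n) =
      (P.map (fun ω => ∑ i ∈ Finset.range n, X i ω)).map (fun x => (√(n : ℝ))⁻¹ * x) := by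
  rw [AEMeasurable.map_map_of_aemeasurable (by fun_prop)
    (Finset.aemeasurable_fun_sum _ fun i _ => (hident i).aemeasurable_fst)]
  congr 1
  ext ω
  simp [normalizedSum, div_eq_inv_mul]

theorem exists_bounded_density_sum (hident : ∀ i, IdentDistrib (X i) (X 0) P P) {n₀ : ℕ}
    (hn₀ : 1 ≤ n₀) {q : ℝ → ℝ} {M : ℝ} (hq : IsDensity (P.map (normalizedSum X n₀)) q)
    (hM : ∀ x, q x ≤ M) :
    ∃ (f : ℝ → ℝ) (M' : ℝ), IsDensity (P.map (fun ω => ∑ i ∈ Finset.range n₀, X i ω)) f ∧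
      ∀ x, f x ≤ M' := by
  have hs : 0 < √(n₀ : ℝ) := Real.sqrt_pos.2 (by exact_mod_cast hn₀)
  have h1 := hq.map_mul_left hs
  have h2 : (P.map (normalizedSum X n₀)).map (fun x => √(n₀ : ℝ) * x) =
      P.map (fun ω => ∑ i ∈ Finset.range n₀, X i ω) := by
    rw [map_normalizedSum hident, Measure.map_map (by fun_prop) (by fun_prop)]
    convert Measure.map_id
    ext x
    simp [hs.ne']
  rw [h2] at h1
  exact ⟨_, (√(n₀ : ℝ))⁻¹ * M, h1, fun x => by gcongr; exact hM _⟩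

/-- The saddle point approximation to the density of the normalized sum, with relative error
`O(1/n)`, in terms of the saddle point `h` that belongs to `τ = x / √n`. -/
theorem exists_saddlePoint_approximation [IsProbabilityMeasure P]
    (hindep : iIndepFun X P)
    (hident : ∀ i, IdentDistrib (X i) (X 0) P P) (hb : 0 < b)
    (hexp : Integrable (fun ω => Real.exp (b * |X 0 ω|)) P) (hvar : cumulant (X 0) P 2 = 1)
    {n₀ : ℕ} (hn₀ : 1 ≤ n₀) {q : ℝ → ℝ} {M : ℝ}
    (hq : IsDensity (P.map (normalizedSum X n₀)) q) (hM : ∀ x, q x ≤ M) :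
    ∃ r C : ℝ, 0 < r ∧ 0 ≤ C ∧ ∀ n : ℕ, 2 * n₀ ≤ n → ∃ p : ℝ → ℝ,
      IsDensity (P.map (normalizedSum X n)) p ∧ Continuous p ∧ (∃ M, ∀ x, p x ≤ M) ∧
      ∀ h τ : ℝ, |h| ≤ r → deriv (logLaplace (X 0) P) h = τ →
        iteratedDeriv 2 (logLaplace (X 0) P) h = iteratedDeriv 2 (cgf (X 0) P) h ∧
        0 < iteratedDeriv 2 (cgf (X 0) P) h ∧
        ∃ E : ℝ, |E| ≤ C / n ∧
          p (√(n : ℝ) * τ) / gaussianPDFReal 0 1 (√(n : ℝ) * τ) =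
            Real.exp (n * (cgf (X 0) P h - τ * h + τ ^ 2 / 2)) /
              √(iteratedDeriv 2 (cgf (X 0) P) h) * (1 + E) := by
  have hX : AEMeasurable (X 0) P := (hident 0).aemeasurable_fst
  have hp : ∀ n, IsProbabilityMeasure (P.map (fun ω => ∑ i ∈ Finset.range n, X i ω)) := fun n =>
    Measure.isProbabilityMeasure_map
      (Finset.aemeasurable_fun_sum _ fun i _ => (hident i).aemeasurable_fst)
  obtain ⟨f, M', hf, hM'⟩ := exists_bounded_density_sum hident hn₀ hq hM
  have := hp n₀
  have hRL : Filter.Tendsto (fun t => charFun (P.map (X 0)) t ^ (2 * n₀)) (Filter.cocompact ℝ)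
      (𝓝 0) := by
    have h1 := hf.tendsto_charFun.pow 2
    rw [charFun_map_sum_range hindep hident] at h1
    simpa [← pow_mul, mul_comm n₀ 2] using h1
  obtain ⟨r, C, hr, hrb, hC, hmain⟩ := exists_saddle_integral_bound hX hb hexp hvar hRL
    (fun h hh => integral_norm_complexMGF_pow_le hindep hident hexp hf hM' hh)
  refine ⟨r, C, hr, hC, fun n hn => ?_⟩
  have hn1 : 1 ≤ n := by omega
  have hn0 : (0 : ℝ) < n := by exact_mod_cast hn1
  have hsn : 0 < √(n : ℝ) := Real.sqrt_pos.2 hn0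
  have hss : √(n : ℝ) * √(n : ℝ) = n := Real.mul_self_sqrt hn0.le
  obtain ⟨g, hg, hgc, hgM⟩ := exists_continuous_density_sum hindep hident hf hM' hn
  have hgn := hg.map_mul_left (inv_pos.2 hsn)
  rw [← map_normalizedSum hident, inv_inv] at hgn
  refine ⟨_, hgn, by fun_prop, ⟨√(n : ℝ) * M', fun x => by gcongr; exact hgM _⟩, ?_⟩
  intro h τ hh hτ
  obtain ⟨hs, hs1, hs2, hI⟩ := hmain h τ hh hτ
  set s := iteratedDeriv 2 (cgf (X 0) P) h
  have hs0 : 0 < s := by linarith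
  have hhb : |h| ≤ b := by linarith
  have := hp n
  obtain ⟨hie, -⟩ := integrable_exp_mul_map_sum hindep hident hexp hhb n
  obtain ⟨hi1, -⟩ := integral_norm_complexMGF_pow_le hindep hident hexp hf hM' (hh.trans hrb)
  have hLh : complexMGF (X 0) P h = Real.exp (cgf (X 0) P h) := by
    rw [complexMGF_ofReal, exp_cgf (integrable_exp_mul_of_abs_le hX hexp hhb)]
  -- the tilted inversion integral converges because `n ≥ 2 n₀`
  have hcont : Continuous fun t : ℝ => complexMGF (X 0) P (h + t * Complex.I) := by
    rw [continuous_iff_continuousAt]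
    intro t
    have h1 : ContinuousAt (complexMGF (X 0) P) (h + t * Complex.I) :=
      (analyticAt_complexMGF_of_abs_lt hX hexp (by simp; linarith)).continuousAt
    exact ContinuousAt.comp (g := complexMGF (X 0) P) h1 (by fun_prop)
  have hint : Integrable fun t : ℝ => complexMGF id
      (P.map (fun ω => ∑ i ∈ Finset.range n, X i ω)) (h + t * Complex.I) := by
    simp only [complexMGF_sum_range hindep hident]
    refine (hi1.const_mul (mgf (X 0) P h ^ (n - 2 * n₀))).mono'
      (hcont.pow n).aestronglyMeasurable (ae_of_all _ fun t => ?_)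
    rw [norm_pow, ← Nat.sub_add_cancel hn, pow_add, Nat.add_sub_cancel]
    gcongr
    simpa using norm_complexMGF_le_mgf (X := X 0) (μ := P) (z := h + t * Complex.I)
  have hinv := hg.mul_exp_eq_integral_complexMGF hgc hie hint (n * τ)
  simp only [complexMGF_sum_range hindep hident] at hinv
  have hF := hI n hn hn1
  set I := ∫ t : ℝ, (complexMGF (X 0) P (h + t * Complex.I) / complexMGF (X 0) P h *
            Complex.exp (-(t * τ * Complex.I))) ^ n with hIdef
  have hinv2 : ((g (n * τ) * Real.exp (h * (n * τ)) : ℝ) : ℂ) =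
      ((2 * Real.pi)⁻¹ * Real.exp (n * cgf (X 0) P h) : ℝ) * I := by
    rw [hinv, hIdef, hLh, Complex.ofReal_mul (2 * Real.pi)⁻¹, mul_assoc,
      ← integral_const_mul ((Real.exp (n * cgf (X 0) P h) : ℝ) : ℂ)]
    congr 1
    refine integral_congr_ae (ae_of_all _ fun t => ?_)
    simp only
    rw [mul_pow, div_pow, ← Complex.exp_nat_mul, ← Complex.ofReal_pow, ← Real.exp_nat_mul]
    have hne : ((Real.exp (n * cgf (X 0) P h) : ℝ) : ℂ) ≠ 0 :=
      Complex.ofReal_ne_zero.2 (Real.exp_pos _).ne'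
    field_simp
    congr 2
    push_cast
    ring
  -- the integral is real
  set c := (2 * Real.pi)⁻¹ * Real.exp (n * cgf (X 0) P h) with hcdef
  have hc : 0 < c := by positivity
  set I' : ℝ := c⁻¹ * (g (n * τ) * Real.exp (h * (n * τ))) with hI'
  have hII : I = (I' : ℂ) := by
    rw [hI', Complex.ofReal_mul, hinv2, ← mul_assoc, ← Complex.ofReal_mul, inv_mul_cancel₀ hc.ne',
      Complex.ofReal_one, one_mul]
  rw [hII, ← Complex.ofReal_sub, Complex.norm_real, Real.norm_eq_abs] at hF
  set w := √(2 * Real.pi / (n * s)) with hw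
  have hw0 : 0 < w := Real.sqrt_pos.2 (by positivity)
  have hw1 : w = √(2 * Real.pi) / (√(n : ℝ) * √s) := by
    rw [hw, Real.sqrt_div (by positivity), Real.sqrt_mul hn0.le]
  refine ⟨hs, hs0, (I' - w) / w, ?_, ?_⟩
  · rw [abs_div, abs_of_pos hw0, div_le_iff₀ hw0]
    refine hF.trans ?_
    have h1 : 1 ≤ √(n : ℝ) * w := by
      rw [hw, ← Real.sqrt_mul hn0.le, Real.one_le_sqrt]
      have : (n : ℝ) * (2 * Real.pi / (n * s)) = 2 * Real.pi / s := by field_simp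
      rw [this, le_div_iff₀ hs0]
      linarith [Real.pi_gt_three]
    calc C / (n * √(n : ℝ)) ≤ C / (n * √(n : ℝ)) * (√(n : ℝ) * w) :=
          le_mul_of_one_le_right (by positivity) h1
      _ = C / n * w := by field_simp
  · have e1 : 1 + (I' - w) / w = I' / w := by field_simp; ring
    have e2 : √(n : ℝ) * (√(n : ℝ) * τ) = n * τ := by rw [← mul_assoc, hss]
    have e3 : gaussianPDFReal 0 1 (√(n : ℝ) * τ) =
        (√(2 * Real.pi))⁻¹ * Real.exp (-(n * (τ ^ 2 / 2))) := by
      rw [gaussianPDFReal]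
      congr 2
      · simp
      · rw [sub_zero, mul_pow, Real.sq_sqrt hn0.le]
        simp
        ring
    have e4 : Real.exp (n * (cgf (X 0) P h - τ * h + τ ^ 2 / 2)) =
        Real.exp (n * cgf (X 0) P h) * (Real.exp (h * (n * τ)))⁻¹ *
          (Real.exp (-(n * (τ ^ 2 / 2))))⁻¹ := by
      rw [← Real.exp_neg, ← Real.exp_neg, ← Real.exp_add, ← Real.exp_add]
      congr 1
      ring
    have h2pi : 0 < √(2 * Real.pi) := Real.sqrt_pos.2 Real.two_pi_pos
    have e5 : (2 * Real.pi)⁻¹ = (√(2 * Real.pi))⁻¹ * (√(2 * Real.pi))⁻¹ := by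
      rw [← mul_inv, Real.mul_self_sqrt Real.two_pi_pos.le]
    have hsq0 : 0 < √s := Real.sqrt_pos.2 hs0
    rw [e1, e2, e3, e4, hI', hw1, hcdef, e5]
    field_simp

end LocalExpansion

/-! ### Cramér's series on the real axis and its leading term -/

theorem isBigO_of_pow_mul_isBigO {D : ℂ → ℂ} (hD : ContinuousAt D 0) {j k : ℕ}
    (h : (fun τ => τ ^ j * D τ) =O[𝓝 0] fun τ => τ ^ (j + k)) :
    D =O[𝓝 0] fun τ => τ ^ k := by
  obtain ⟨c, hc⟩ := h.bound
  have h1 : ∀ᶠ τ : ℂ in 𝓝[≠] 0, ‖D τ‖ ≤ c * ‖τ ^ k‖ := by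
    filter_upwards [hc.filter_mono nhdsWithin_le_nhds, self_mem_nhdsWithin] with τ hτ hτ0
    have hpos : 0 < ‖τ‖ ^ j := pow_pos (norm_pos_iff.2 hτ0) j
    rw [pow_add, norm_mul, norm_mul, norm_pow τ j, mul_left_comm] at hτ
    exact le_of_mul_le_mul_left hτ hpos
  have h2 : ‖D 0‖ ≤ c * ‖(0 : ℂ) ^ k‖ :=
    le_of_tendsto_of_tendsto (hD.norm.tendsto.mono_left nhdsWithin_le_nhds)
      (((by fun_prop : Continuous fun τ : ℂ => c * ‖τ ^ k‖).tendsto 0).mono_left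
        nhdsWithin_le_nhds) h1
  refine Asymptotics.IsBigO.of_bound c ?_
  rw [eventually_nhdsWithin_iff] at h1
  filter_upwards [h1] with τ hτ
  rcases eq_or_ne τ 0 with rfl | h0
  · exact h2
  · exact hτ h0

/-- If `τ ^ j * lam τ` is real on the real axis, then so is `lam`; at `0` this uses continuity. -/
theorem eventually_im_eq_zero_of_pow_mul {lam : ℂ → ℂ} (hlam : ContinuousAt lam 0) {j : ℕ}
    {v : ℝ → ℝ} (h : ∀ᶠ t : ℝ in 𝓝 0, (t : ℂ) ^ j * lam t = v t) :
    ∀ᶠ t : ℝ in 𝓝 0, (lam t).im = 0 := by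
  have h1 : ∀ᶠ t : ℝ in 𝓝 0, t ≠ 0 → (lam t).im = 0 := by
    filter_upwards [h] with t ht ht0
    rw [← Complex.ofReal_pow] at ht
    have h2 := congrArg Complex.im ht
    rw [Complex.im_ofReal_mul, Complex.ofReal_im] at h2
    exact (mul_eq_zero.1 h2).resolve_left (pow_ne_zero j ht0)
  have hc : Filter.Tendsto (fun t : ℝ => (lam t).im) (𝓝 0) (𝓝 (lam 0).im) := by
    have h3 : Filter.Tendsto (fun t : ℝ => (t : ℂ)) (𝓝 0) (𝓝 0) := by
      simpa using Complex.continuous_ofReal.tendsto 0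
    exact (Complex.continuous_im.tendsto _).comp (hlam.tendsto.comp h3)
  have h0 : (lam 0).im = 0 := by
    refine tendsto_nhds_unique (hc.mono_left (nhdsWithin_le_nhds (s := {0}ᶜ))) ?_
    refine tendsto_const_nhds.congr' ?_
    rw [Filter.EventuallyEq, eventually_nhdsWithin_iff]
    filter_upwards [h1] with t ht ht0
    exact (ht ht0).symm
  filter_upwards [h1] with t ht
  rcases eq_or_ne t 0 with rfl | ht0
  · simpa using h0
  · exact ht ht0

theorem theorem1p2 {Ω : Type*} [MeasurableSpace Ω] (P : Measure Ω) [IsProbabilityMeasure P]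
    (X : ℕ → Ω → ℝ) (hindep : iIndepFun X P) (hident : ∀ i, IdentDistrib (X i) (X 0) P P)
    (hmean : ∫ ω, X 0 ω ∂P = 0) (hvar : variance (X 0) P = 1)
    (b : ℝ) (hb : 0 < b) (hexp : Integrable (fun ω => Real.exp (b * |X 0 ω|)) P)
    (n₀ : ℕ) (hn₀ : 1 ≤ n₀)
    (hdens : ∃ (q : ℝ → ℝ) (M : ℝ), IsDensity (P.map (normalizedSum X n₀)) q ∧ ∀ x, q x ≤ M) :
    ∃ (τ₀ C : ℝ) (z₀ lam mu : ℂ → ℂ), 0 < τ₀ ∧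
      -- `lam` (the Cramér series) and `mu`, given by the saddle point, are analytic in the
      -- closed disc of radius `τ₀` and real on the real axis
      IsSaddlePoint (X 0) P τ₀ z₀ ∧
      AnalyticOnNhd ℂ lam (Metric.closedBall 0 τ₀) ∧
      AnalyticOnNhd ℂ mu (Metric.closedBall 0 τ₀) ∧
      (∀ τ ∈ Metric.closedBall (0 : ℂ) τ₀,
        τ ^ 3 * lam τ = logLaplace (X 0) P (z₀ τ) - τ * z₀ τ + τ ^ 2 / 2) ∧
      (∀ τ ∈ Metric.closedBall (0 : ℂ) τ₀,
        mu τ = Complex.log (iteratedDeriv 2 (logLaplace (X 0) P) (z₀ τ)) / 2) ∧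
      (∀ t : ℝ, |t| ≤ τ₀ → (lam (t : ℂ)).im = 0 ∧ (mu (t : ℂ)).im = 0) ∧
      mu 0 = 0 ∧
      -- `Z_n` has a (unique) continuous density, which is bounded and has the claimed expansion
      (∀ n : ℕ, 2 * n₀ ≤ n → ∃ p : ℝ → ℝ,
        IsDensity (P.map (normalizedSum X n)) p ∧ Continuous p ∧ (∃ M, ∀ x, p x ≤ M) ∧
        ∀ x τ : ℝ, τ = x / √(n : ℝ) → |τ| ≤ τ₀ →
          ∃ B : ℝ, |B| ≤ C ∧
            p x / gaussianPDFReal 0 1 x =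
              Real.exp (n * τ ^ 3 * (lam (τ : ℂ)).re - (mu (τ : ℂ)).re) *
                (1 + B * ((Real.log n) ^ 3 / n))) ∧
      -- leading terms at zero, when `X` is not normal
      (P.map (X 0) ≠ gaussianReal 0 1 → ∃ m : ℕ, IsFirstCumulantOrder (X 0) P m ∧
        (fun τ : ℂ => lam τ - (cumulant (X 0) P m : ℂ) / (m.factorial : ℂ) * τ ^ (m - 3))
          =O[𝓝 0] (fun τ : ℂ => τ ^ (m - 2)) ∧
        (fun τ : ℂ => mu τ -
            (cumulant (X 0) P m : ℂ) / (2 * ((m - 2).factorial : ℂ)) * τ ^ (m - 2))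
          =O[𝓝 0] (fun τ : ℂ => τ ^ (m - 1))) := by
  have hX : AEMeasurable (X 0) P := (hident 0).aemeasurable_fst
  obtain ⟨q, M, hq, hM⟩ := hdens
  set K := logLaplace (X 0) P
  have hKof : ∀ t : ℝ, K t = cgf (X 0) P t := logLaplace_ofReal
  have hK : AnalyticAt ℂ K 0 := analyticAt_logLaplace_zero hX hb hexp
  have hder : ∀ k, iteratedDeriv k K 0 = cumulant (X 0) P k :=
    iteratedDeriv_logLaplace_zero hX hb hexp
  have hc1 : cumulant (X 0) P 1 = 0 := cumulant_one hX hb hexp hmean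
  have hc2 : cumulant (X 0) P 2 = 1 := by rw [cumulant_two hX hb hexp hmean, hvar]
  have hK0 : K 0 = 0 := by simpa [cumulant_zero] using hder 0
  have hK1 : deriv K 0 = 0 := by simpa [hc1] using hder 1
  have hK2 : iteratedDeriv 2 K 0 = 1 := by rw [hder, hc2, Complex.ofReal_one]
  have hκ : AnalyticAt ℝ (cgf (X 0) P) 0 :=
    analyticAt_cgf (mem_interior_integrableExpSet hX hexp (by simpa using hb))
  obtain ⟨z₀, hz, hz0, hsad, hzreal⟩ := exists_saddlePoint hK hκ hKof
    (by rw [cumulant, iteratedDeriv_one] at hc1; exact hc1) hc2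
  obtain ⟨lam, hlam, hlameq⟩ := exists_cramerSeries hK hK0 hK1 hK2 hz hz0 hsad
  set mu : ℂ → ℂ := fun τ => Complex.log (iteratedDeriv 2 K (z₀ τ)) / 2 with hmudef
  have hmu : AnalyticAt ℂ mu 0 := by
    have h1 : AnalyticAt ℂ (fun τ => iteratedDeriv 2 K (z₀ τ)) 0 :=
      AnalyticAt.comp (g := iteratedDeriv 2 K) (f := z₀)
        (by rw [hz0]; exact hK.iteratedDeriv_apply 2) hz
    refine (h1.clog ?_).div analyticAt_const two_ne_zero
    rw [hz0, hK2]
    exact Complex.one_mem_slitPlane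
  obtain ⟨r, C, hr, hC, hdensity⟩ :=
    exists_saddlePoint_approximation hindep hident hb hexp hc2 hn₀ hq hM
  have hzt : ∀ᶠ τ in 𝓝 0, ‖z₀ τ‖ < r :=
    hz.continuousAt.norm.eventually_lt_const (by simpa [hz0] using hr)
  have hcoe : Filter.Tendsto (fun t : ℝ => (t : ℂ)) (𝓝 0) (𝓝 0) := by
    simpa using Complex.continuous_ofReal.tendsto 0
  have hlamreal : ∀ᶠ t : ℝ in 𝓝 0, (lam t).im = 0 := by
    refine eventually_im_eq_zero_of_pow_mul hlam.continuousAt (j := 3)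
      (v := fun t => cgf (X 0) P (z₀ t).re - t * (z₀ t).re + t ^ 2 / 2) ?_
    filter_upwards [hcoe.eventually hlameq, hzreal] with t ht ht2
    have hzre : z₀ t = ((z₀ t).re : ℂ) := Complex.ext rfl (by simpa using ht2)
    rw [ht, hzre, hKof]
    push_cast
    rfl
  -- one disc on which all of this holds
  obtain ⟨ε₁, hε₁, hball₁⟩ := Metric.eventually_nhds_iff_ball.1
    (hz.eventually_analyticAt.and (hlam.eventually_analyticAt.and (hmu.eventually_analyticAt.and
      (hsad.and (hlameq.and hzt)))))
  obtain ⟨ε₂, hε₂, hball₂⟩ := Metric.eventually_nhds_iff_ball.1 (hzreal.and hlamreal)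
  set τ₀ := min ε₁ ε₂ / 2 with hτ₀
  have hτ₀pos : 0 < τ₀ := by positivity
  have hτ₁ : ∀ τ ∈ Metric.closedBall (0 : ℂ) τ₀, τ ∈ Metric.ball (0 : ℂ) ε₁ := by
    intro τ hτ
    rw [mem_closedBall_zero_iff] at hτ
    rw [mem_ball_zero_iff]
    linarith [min_le_left ε₁ ε₂, hτ₀]
  have hτ₂ : ∀ t : ℝ, |t| ≤ τ₀ → (z₀ t).im = 0 ∧ (lam t).im = 0 := by
    intro t ht
    refine hball₂ t ?_
    rw [mem_ball_zero_iff, Real.norm_eq_abs]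
    linarith [min_le_right ε₁ ε₂, hτ₀]
  have hcl : ∀ t : ℝ, |t| ≤ τ₀ → (t : ℂ) ∈ Metric.closedBall (0 : ℂ) τ₀ := by
    intro t ht
    simpa using ht
  -- the saddle point on the real axis
  have hsp : ∀ t : ℝ, |t| ≤ τ₀ → ∃ h : ℝ, z₀ t = h ∧ |h| ≤ r ∧ deriv K h = t := by
    intro t ht
    obtain ⟨-, -, -, h4, -, h6⟩ := hball₁ t (hτ₁ t (hcl t ht))
    have hzre : z₀ t = ((z₀ t).re : ℂ) := Complex.ext rfl (by simpa using (hτ₂ t ht).1)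
    refine ⟨(z₀ t).re, hzre, (Complex.abs_re_le_norm _).trans h6.le, ?_⟩
    rw [← hzre, h4]
  have hmureal : ∀ (h s : ℝ) (τ : ℂ), z₀ τ = h → iteratedDeriv 2 K h = s → 0 < s →
      mu τ = ((Real.log s / 2 : ℝ) : ℂ) := by
    intro h s τ hzτ hs hs0
    simp only [hmudef]
    rw [hzτ, hs, ← Complex.ofReal_log hs0.le]
    push_cast
    rfl
  refine ⟨τ₀, C / Real.log 2 ^ 3, z₀, lam, mu, hτ₀pos, ⟨fun τ hτ => (hball₁ τ (hτ₁ τ hτ)).1, hz0,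
    fun τ hτ => (hball₁ τ (hτ₁ τ hτ)).2.2.2.1⟩, fun τ hτ => (hball₁ τ (hτ₁ τ hτ)).2.1,
    fun τ hτ => (hball₁ τ (hτ₁ τ hτ)).2.2.1, fun τ hτ => (hball₁ τ (hτ₁ τ hτ)).2.2.2.2.1,
    fun τ _ => rfl, ?_, ?_, ?_, ?_⟩
  · intro t ht
    refine ⟨(hτ₂ t ht).2, ?_⟩
    obtain ⟨h, hzh, hhr, hdh⟩ := hsp t ht
    obtain ⟨p, -, -, -, hp⟩ := hdensity (2 * n₀) le_rfl
    obtain ⟨hs, hs0, -⟩ := hp h t hhr hdh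
    rw [hmureal h _ t hzh hs hs0, Complex.ofReal_im]
  · simp [hmudef, hz0, hK2]
  · intro n hn
    have hn2 : (2 : ℝ) ≤ n := by exact_mod_cast (by omega : 2 ≤ n)
    have hn0 : (0 : ℝ) < n := by linarith
    have hsn : √(n : ℝ) ≠ 0 := (Real.sqrt_pos.2 hn0).ne'
    obtain ⟨p, hp1, hp2, hp3, hp⟩ := hdensity n hn
    refine ⟨p, hp1, hp2, hp3, fun x τ hτ hτ0 => ?_⟩
    obtain ⟨h, hzh, hhr, hdh⟩ := hsp τ hτ0
    obtain ⟨hs, hs0, E, hE, hpE⟩ := hp h τ hhr hdh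
    set s := iteratedDeriv 2 (cgf (X 0) P) h
    have hx : √(n : ℝ) * τ = x := by rw [hτ]; field_simp
    rw [hx] at hpE
    have hl2 : 0 < Real.log 2 := Real.log_pos (by norm_num)
    have hln : Real.log 2 ≤ Real.log n := Real.log_le_log (by norm_num) hn2
    have hln0 : 0 < Real.log n := hl2.trans_le hln
    refine ⟨E * (n / Real.log n ^ 3), ?_, ?_⟩
    · rw [abs_mul, abs_of_pos (by positivity : 0 < (n : ℝ) / Real.log n ^ 3)]
      calc _ ≤ C / n * (n / Real.log n ^ 3) := by gcongr
        _ = C / Real.log n ^ 3 := by field_simp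
        _ ≤ _ := by gcongr
    · have e1 : E * (n / Real.log n ^ 3) * (Real.log n ^ 3 / n) = E := by field_simp
      have e2 : τ ^ 3 * (lam τ).re = cgf (X 0) P h - τ * h + τ ^ 2 / 2 := by
        have h5 := (hball₁ τ (hτ₁ τ (hcl τ hτ0))).2.2.2.2.1
        rw [hzh, hKof, ← Complex.ofReal_pow] at h5
        have h6 := congrArg Complex.re h5
        rw [Complex.re_ofReal_mul] at h6
        rw [h6, ← Complex.ofReal_mul, ← Complex.ofReal_sub, ← Complex.ofReal_pow]
        simp [-Complex.ofReal_pow]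
      rw [hpE, e1, hmureal h s τ hzh hs hs0, Complex.ofReal_re, Real.exp_sub, Real.exp_half,
        Real.exp_log hs0, mul_assoc (n : ℝ), e2]
  · intro hne
    obtain ⟨m, hm⟩ := exists_isFirstCumulantOrder hX hb hexp hmean hvar hne
    have h3 := hm.three_le
    obtain ⟨a1, a2⟩ := saddlePoint_expansions hK hK0 hK1 hK2 hz hz0 hsad hm.three_le
      (fun k hk hkm => by rw [hder, hm.eq_zero k hk hkm, Complex.ofReal_zero])
    rw [hder] at a1 a2
    refine ⟨m, hm, ?_, a2⟩
    refine isBigO_of_pow_mul_isBigO (j := 3) ?_ ?_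
    · have := hlam.continuousAt
      fun_prop
    · rw [show 3 + (m - 2) = m + 1 by omega]
      refine a1.congr' ?_ Filter.EventuallyEq.rfl
      filter_upwards [hlameq] with τ hτ
      have hpow : τ ^ m = τ ^ 3 * τ ^ (m - 3) := by rw [← pow_add]; congr 1; omega
      rw [← hτ, hpow]
      ring
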